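/- For an interval $\Delta\subset\mathbb{R}$ let $\mathcal{M}(\Delta)$ be the class of Borel measures $s$ of constant sign whose support consists of infinitely many points and is contained in $\Delta$, with $x^\nu\in L_1(s)$ for all $\nu=0,1,2,\dots$. Put $\widehat{s}(z)=\int\frac{ds(x)}{z-x}$, and, when $\widehat{\beta}\in L_1(\alpha)$, let $\langle\alpha,\beta\rangle$ be the measure $d\langle\alpha,\beta\rangle(x)=\widehat{\beta}(x)\,d\alpha(x)$. Let $m\ge 2$ and let $\sigma_1,\dots,\sigma_m$ be measures with $\sigma_j\in\mathcal{M}(\Delta_j)$, where $\Delta_j$ is the convex hull of $\operatorname{supp}\sigma_j$. Suppose that for $1\le j<m$ the set $\Delta_j\cap\Delta_{j+1}$ is empty or a single point which is not a mass point of $\sigma_j$ or of $\sigma_{j+1}$. Suppose also that all the products $s_{j,j}=\sigma_j$, $s_{j,k}=\langle\sigma_j,s_{j+1,k}\rangle$ $(1\le j<k\le m)$ are defined, that is, $\widehat{s}_{j+1,k}\in L_1(\sigma_j)$. In other words, $(\sigma_1,\dots,\sigma_m)$ generates a Nikishin system $\mathcal{N}(\sigma_1,\dots,\sigma_m)$;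 then $(\sigma_m,\dots,\sigma_1)$ generates a Nikishin system as well. For $n=0,1,2,\dots$, a multi-level (ML) Hermite–Padé vector of order $n$ of $\mathcal{N}(\sigma_1,\dots,\sigma_m)$ is a non-zero vector of polynomials $(a_{n,0},\dots,a_{n,m})$ with $\deg a_{n,j}\le n-1$ for $j<m$ and $\deg a_{n,m}\le n$ (for $n=0$ this means $a_{0,j}=0$ for $j<m$ and $a_{0,m}$ constant) such that the forms $$\mathcal{A}_{n,j}(z)=(-1)^j a_{n,j}(z)+\sum_{k=j+1}^m(-1)^k a_{n,k}(z)\,\widehat{s}_{j+1,k}(z),\qquad j=0,\dots,m-1,$$ satisfy $\mathcal{A}_{n,0}(z)=\mathcal{O}(1/z^{n+1})$ and $\mathcal{A}_{n,j}(z)=\mathcal{O}(1/z)$ for $j=1,\dots,m-1$, where $z\to\infty$ non-tangentially to $\Delta_{j+1}$, that is, in each region $\operatorname{dist}(z,\Delta_{j+1})\ge c|z|$ with $c>0$. Define the Cauchy convolution kernel by $K(x_1,x_2)=\frac{1}{x_1-x_2}$ if $m=2$, and, for $m>2$, by $$K(x_1,x_m)=\int_{\Delta_2}\cdots\int_{\Delta_{m-1}}\frac{d\sigma_{m-1}(x_{m-1})\cdots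 d\sigma_2(x_2)}{(x_1-x_2)(x_2-x_3)\cdots(x_{m-1}-x_m)}.$$ Theorem. For every $n=0,1,2,\dots$ let $(a_{n,0},\dots,a_{n,m})$ be an ML Hermite–Padé vector of order $n$ of $\mathcal{N}(\sigma_1,\dots,\sigma_m)$, and for every $k=0,1,2,\dots$ let $(b_{k,0},\dots,b_{k,m})$ be an ML Hermite–Padé vector of order $k$ of the reversed system $\mathcal{N}(\sigma_m,\dots,\sigma_1)$. Then there are numbers $h_n\ne 0$ such that for all $n$ and $k$ $$\int_{\Delta_1}\int_{\Delta_m} b_{k,m}(x_1)\,K(x_1,x_m)\,a_{n,m}(x_m)\,d\sigma_m(x_m)\,d\sigma_1(x_1)=h_n\,\delta_{n,k},$$ where $\delta_{n,k}$ is the Kronecker delta and the integrand is absolutely integrable with respect to $|\sigma_1|\times|\sigma_m|$. -/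

import Mathlib

open MeasureTheory Filter Polynomial

namespace Nikishin

noncomputable section

/-- Support of a finite real Borel measure. -/
def supp (s : SignedMeasure ℝ) : Set ℝ := s.variation.support

/-- The convex hull `Co (supp s)`. -/
def hull (s : SignedMeasure ℝ) : Set ℝ := convexHull ℝ (supp s)

/-- The class `𝓜(Δ)`: Borel measures of constant sign, whose support has infinitely many points and
is contained in `Δ`, with finite moments of all orders. (The moment of order `0` being finite, such
a measure is finite, so it is a `SignedMeasure`.) -/
structure ClassM (s : SignedMeasure ℝ) (Δ : Set ℝ) : Prop where
  constSign : 0 ≤ s ∨ s ≤ 0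
  infinite_supp : (supp s).Infinite
  supp_subset : supp s ⊆ Δ
  moments : ∀ ν : ℕ, s.Integrable (fun x : ℝ => x ^ ν)

/-- The Cauchy transform `ŝ(x) = ∫ ds(t) / (x - t)` at a real point `x`. -/
def cauchyReal (s : SignedMeasure ℝ) (x : ℝ) : ℝ := ∫ᵛ t, (x - t)⁻¹ ∂•s

/-- The Cauchy transform `ŝ(z) = ∫ ds(t) / (z - t)` at a complex point `z`. -/
def cauchy (s : SignedMeasure ℝ) (z : ℂ) : ℂ := ∫ᵛ t, (z - (t : ℂ))⁻¹ ∂<•s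

/-- The measure `⟨α, β⟩`, defined by `d⟨α, β⟩(x) = β̂(x) dα(x)`. -/
def bracket (α β : SignedMeasure ℝ) : SignedMeasure ℝ :=
  α.withDensity (cauchyReal β) (ContinuousLinearMap.lsmul ℝ ℝ)

/-- `chain σ l j = ⟨σ_j, ⟨σ_{j+1}, …, σ_{j+l}⟩⟩`. -/
def chain (σ : ℕ → SignedMeasure ℝ) : ℕ → ℕ → SignedMeasure ℝ
  | 0, j => σ j
  | l + 1, j => bracket (σ j) (chain σ l (j + 1))

/-- `s_{j,k} = ⟨σ_j, …, σ_k⟩` for `j ≤ k`; in particular `s_{j,j} = σ_j`. -/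
def sMeas (σ : ℕ → SignedMeasure ℝ) (j k : ℕ) : SignedMeasure ℝ := chain σ (k - j) j

/-- `(σ_1, …, σ_m)` generates a Nikishin system. The values `σ_j` with `j` outside `{1, …, m}` play
no role. The intervals are `Δ_j = Co (supp σ_j)`. -/
structure IsGenerator (m : ℕ) (σ : ℕ → SignedMeasure ℝ) : Prop where
  mem_classM : ∀ j, 1 ≤ j → j ≤ m → ClassM (σ j) (hull (σ j))
  inter_subsingleton : ∀ j, 1 ≤ j → j < m → (hull (σ j) ∩ hull (σ (j + 1))).Subsingleton
  not_mass : ∀ j, 1 ≤ j → j < m → ∀ x ∈ hull (σ j) ∩ hull (σ (j + 1)),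
    σ j {x} = 0 ∧ σ (j + 1) {x} = 0
  /-- `ŝ_{j+1,k} ∈ L₁(σ_j)`, so that `s_{j,k} = ⟨σ_j, s_{j+1,k}⟩` is defined. -/
  integrable : ∀ j k, 1 ≤ j → j < k → k ≤ m → (σ j).Integrable (cauchyReal (sMeas σ (j + 1) k))

/-- The reversed family `(σ_m, …, σ_1)`. -/
def reversed (m : ℕ) (σ : ℕ → SignedMeasure ℝ) : ℕ → SignedMeasure ℝ := fun j => σ (m + 1 - j)

/-- `f(z) = O(1/z^N)` as `z → ∞` non-tangentially to `Δ ⊆ ℝ`, that is, in each of the regions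
`dist(z, Δ) ≥ c |z|`, `c > 0`. For bounded `Δ` and `c < 1` such a region is a full neighbourhood
of `∞`. -/
def IsBigOInfty (Δ : Set ℝ) (f : ℂ → ℂ) (N : ℕ) : Prop :=
  ∀ c : ℝ, 0 < c →
    f =O[Bornology.cobounded ℂ ⊓ 𝓟 {z : ℂ | c * ‖z‖ ≤ Metric.infDist z (Complex.ofReal '' Δ)}]
      (fun z : ℂ => (z ^ N)⁻¹)

/-- The linear form `𝓐_j = (-1)^j a_j + ∑_{k=j+1}^m (-1)^k a_k ŝ_{j+1,k}`. -/
def form (m : ℕ) (σ : ℕ → SignedMeasure ℝ) (a : ℕ → ℂ[X]) (j : ℕ) (z : ℂ) : ℂ :=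
  (-1) ^ j * (a j).eval z +
    ∑ k ∈ Finset.Icc (j + 1) m, (-1) ^ k * (a k).eval z * cauchy (sMeas σ (j + 1) k) z

/-- `(a_0, …, a_m)` is a vector of multi-level Hermite–Padé polynomials of order `n` of
`𝓝(σ_1, …, σ_m)`. (The values `a j` with `j > m` play no role. Having `degree < n` means degree at
most `n - 1`, with only the zero polynomial allowed when `n = 0`.) -/
structure IsML (m : ℕ) (σ : ℕ → SignedMeasure ℝ) (n : ℕ) (a : ℕ → ℂ[X]) : Prop where
  degree_lt : ∀ j < m, (a j).degree < n
  degree_le : (a m).degree ≤ n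
  nonzero : ∃ j ≤ m, a j ≠ 0
  form_zero : IsBigOInfty (hull (σ 1)) (form m σ a 0) (n + 1)
  form_pos : ∀ j, 1 ≤ j → j < m → IsBigOInfty (hull (σ (j + 1))) (form m σ a j) 1

/-- Iterated Cauchy kernel with the `l` intermediate measures `σ_j, …, σ_{j+l-1}`, the integral
with respect to `σ_j` being the outermost one. -/
def kernelAux (σ : ℕ → SignedMeasure ℝ) : ℕ → ℕ → ℝ → ℝ → ℝ
  | 0, _, x, y => (x - y)⁻¹
  | l + 1, j, x, y => ∫ᵛ t, (x - t)⁻¹ * kernelAux σ l (j + 1) t y ∂•(σ j)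

/-- The Cauchy convolution kernel `K(x_1, x_m)` for `m ≥ 2`; the intermediate measures are
`σ_2, …, σ_{m-1}`. -/
def kernel (m : ℕ) (σ : ℕ → SignedMeasure ℝ) (x y : ℝ) : ℝ := kernelAux σ (m - 2) 2 x y

/-- The integrand `q(x_1) K(x_1, x_m) p(x_m)`. -/
def pairingIntegrand (m : ℕ) (σ : ℕ → SignedMeasure ℝ) (q p : ℂ[X]) (x y : ℝ) : ℂ :=
  q.eval (x : ℂ) * (kernel m σ x y : ℂ) * p.eval (y : ℂ)

/-- `∫ ∫ q(x_1) K(x_1, x_m) p(x_m) dσ_m(x_m) dσ_1(x_1)`. (The measures live on `Δ_1` and `Δ_m`.) -/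
def pairing (m : ℕ) (σ : ℕ → SignedMeasure ℝ) (q p : ℂ[X]) : ℂ :=
  ∫ᵛ x, (∫ᵛ y, pairingIntegrand m σ q p x y ∂<•(σ m)) ∂<•(σ 1)

end

end Nikishin

/-! Since each σ_j has constant sign, it is `ε j` times a positive measure `μ j`. The form 𝓐_j and
the Cauchy transform of 𝓐_{j+1} dσ_{j+1} differ by a polynomial; both tend to 0 along the imaginary
axis, so they coincide (`System.form_eq_integral`). Descending from 𝓐_m = (-1)^m a_m, the form 𝓐_1
is, up to sign, the iterated Cauchy transform of a_m, and the decay of 𝓐_0 of order n + 1 kills the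
moments of 𝓐_1 dσ_1 of order below n (`moments_eq_zero`). So a_{n,m} is orthogonal to x^k, k < n,
for the form `bilin`, which is the pairing with the kernel K by Fubini (`System.pairing_eq_bilin`).

Moving the Cauchy kernels one by one from one factor to the other, each at the cost of a factor -1,
turns `bilin` into the form of the reversed system with its arguments exchanged
(`System.bilin_comm`). Hence b_{k,m} is orthogonal to lower degrees from the other side, and the
off-diagonal pairings vanish once the degrees are known to be exactly n and k.

Exact degrees and h_n ≠ 0 both follow from nondegeneracy (`System.eq_zero_of_bilin`). The iterated
transform of a nonzero real polynomial of degree at most N has at most N zeros on the first interval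
(`System.card_zeros_iterCauchy_le`), while orthogonality to all polynomials of degree at most N
would force N + 1 of them (`exists_zeros_of_orthogonal`).

Absolute convergence holds because kernels and measures of constant sign allow no cancellation, so
the hypotheses on s_{j,k} already bound the absolute iterated integrals (`PreSystem.toSystem`).
Polynomial weights are then absorbed by the moments, since points of consecutive intervals come
close to each other only in a bounded region (`weight_mul_inv_le`). -/

namespace Nikishin

open scoped ENNReal Topology

noncomputable section

/-! ### Iterated Cauchy transforms and their absolute versions -/

section IteratedTransforms

variable {E : Type*} [NormedAddCommGroup E] [NormedSpace ℝ E]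

/-- The `l`-fold iterated Cauchy transform of `g` with respect to the measures
`ε j • μ j, …, ε (j + l - 1) • μ (j + l - 1)`, the first of them being the outermost. -/
def iterCauchy (μ : ℕ → Measure ℝ) (ε : ℕ → ℝ) (g : ℝ → E) : ℕ → ℕ → ℝ → E
  | 0, _, x => g x
  | l + 1, j, x => ε j • ∫ t, (x - t)⁻¹ • iterCauchy μ ε g l (j + 1) t ∂μ j

/-- The absolute version of `iterCauchy`. -/
def absCauchy (μ : ℕ → Measure ℝ) (g : ℝ → ℝ≥0∞) : ℕ → ℕ → ℝ → ℝ≥0∞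
  | 0, _, x => g x
  | l + 1, j, x => ∫⁻ t, ‖(x - t)⁻¹‖ₑ * absCauchy μ g l (j + 1) t ∂μ j

variable {μ : ℕ → Measure ℝ} {ε : ℕ → ℝ} [∀ j, IsFiniteMeasure (μ j)]

lemma measurable_inv_sub : Measurable fun p : ℝ × ℝ => (p.1 - p.2)⁻¹ := by fun_prop

lemma measurable_absCauchy {g : ℝ → ℝ≥0∞} (hg : Measurable g) (l j : ℕ) :
    Measurable (absCauchy μ g l j) := by
  induction l generalizing j with
  | zero => exact hg
  | succ l ih =>
    refine Measurable.lintegral_prod_right'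
      (f := fun p : ℝ × ℝ => ‖(p.1 - p.2)⁻¹‖ₑ * absCauchy μ g l (j + 1) p.2) ?_
    exact measurable_inv_sub.enorm.mul ((ih (j + 1)).comp measurable_snd)

lemma stronglyMeasurable_iterCauchy {g : ℝ → E} (hg : StronglyMeasurable g) (l j : ℕ) :
    StronglyMeasurable (iterCauchy μ ε g l j) := by
  induction l generalizing j with
  | zero => exact hg
  | succ l ih =>
    refine StronglyMeasurable.const_smul (StronglyMeasurable.integral_prod_right
      (f := fun x t => (x - t)⁻¹ • iterCauchy μ ε g l (j + 1) t) ?_) (ε j)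
    exact measurable_inv_sub.stronglyMeasurable.smul ((ih (j + 1)).comp_measurable measurable_snd)

omit [∀ j, IsFiniteMeasure (μ j)] in
lemma absCauchy_mono {g h : ℝ → ℝ≥0∞} (hgh : ∀ x, g x ≤ h x) (l j : ℕ) (x : ℝ) :
    absCauchy μ g l j x ≤ absCauchy μ h l j x := by
  induction l generalizing j x with
  | zero => exact hgh x
  | succ l ih => exact lintegral_mono fun t => mul_le_mul_right (ih (j + 1) t) _

lemma absCauchy_const_mul {g : ℝ → ℝ≥0∞} (hg : Measurable g) (c : ℝ≥0∞) (l j : ℕ) (x : ℝ) :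
    absCauchy μ (fun y => c * g y) l j x = c * absCauchy μ g l j x := by
  induction l generalizing j x with
  | zero => rfl
  | succ l ih =>
    simp only [absCauchy, ih]
    rw [← lintegral_const_mul]
    · exact lintegral_congr fun t => by ring
    · exact (by fun_prop : Measurable fun t : ℝ => ‖(x - t)⁻¹‖ₑ).mul (measurable_absCauchy hg _ _)

omit [∀ j, IsFiniteMeasure (μ j)] in
lemma enorm_iterCauchy_le (hε : ∀ j, ε j = 1 ∨ ε j = -1) (g : ℝ → E) (l j : ℕ) (x : ℝ) :
    ‖iterCauchy μ ε g l j x‖ₑ ≤ absCauchy μ (fun y => ‖g y‖ₑ) l j x := by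
  induction l generalizing j x with
  | zero => exact le_rfl
  | succ l ih =>
    have h1 : ‖ε j‖ₑ = 1 := by rcases hε j with h | h <;> simp [h]
    simp only [iterCauchy, absCauchy, enorm_smul, h1, one_mul]
    refine (enorm_integral_le_lintegral_enorm _).trans (lintegral_mono fun t => ?_)
    rw [enorm_smul]
    exact mul_le_mul_right (ih (j + 1) t) _

end IteratedTransforms

/-! ### Polynomial weights and absolute convergence -/

/-- The weight `(1 + |x|) ^ n`. -/
def weight (n : ℕ) (x : ℝ) : ℝ≥0∞ := (1 + ‖x‖ₑ) ^ n

lemma measurable_weight (n : ℕ) : Measurable (weight n) := by unfold weight; fun_prop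

lemma weight_ne_top (n : ℕ) (x : ℝ) : weight n x ≠ ∞ := by unfold weight; finiteness

@[simp] lemma weight_zero : weight 0 = fun _ => 1 := by ext; simp [weight]

lemma enorm_eval_le_weight (p : ℂ[X]) {n : ℕ} (hp : p.natDegree ≤ n) :
    ∃ C : ℝ≥0∞, C ≠ ∞ ∧ ∀ x : ℝ, ‖p.eval (x : ℂ)‖ₑ ≤ C * weight n x := by
  refine ⟨∑ i ∈ Finset.range (n + 1), ‖p.coeff i‖ₑ,
    ENNReal.sum_ne_top.2 fun i _ => enorm_ne_top, fun x => ?_⟩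
  rw [eval_eq_sum_range' (Nat.lt_succ_of_le hp), Finset.sum_mul]
  refine (enorm_sum_le _ _).trans (Finset.sum_le_sum fun i hi => ?_)
  rw [enorm_mul, enorm_pow]
  refine mul_le_mul_right ?_ _
  have h : ‖(x : ℂ)‖ₑ = ‖x‖ₑ := by simp [← ofReal_norm]
  rw [h]
  calc ‖x‖ₑ ^ i ≤ (1 + ‖x‖ₑ) ^ i := pow_le_pow_left' le_add_self i
    _ ≤ (1 + ‖x‖ₑ) ^ n := pow_le_pow_right₀ le_self_add (by simp at hi; omega)

/-- The hypotheses on a family of measures `ε_1 • μ_1, …, ε_m • μ_m` that concern consecutive pairs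
only: supporting intervals `Δ_j`, separation, and moments. -/
structure PreSystem (m : ℕ) (μ : ℕ → Measure ℝ) (ε : ℕ → ℝ) (Δ : ℕ → Set ℝ) : Prop where
  sign : ∀ j, ε j = 1 ∨ ε j = -1
  isClosed : ∀ j, 1 ≤ j → j ≤ m → IsClosed (Δ j)
  ordConnected : ∀ j, 1 ≤ j → j ≤ m → (Δ j).OrdConnected
  ae_mem : ∀ j, 1 ≤ j → j ≤ m → ∀ᵐ x ∂μ j, x ∈ Δ j
  not_finite : ∀ j, 1 ≤ j → j ≤ m → ∀ s : Finset ℝ, ¬ ∀ᵐ x ∂μ j, x ∈ s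
  separated : ∀ j, 1 ≤ j → j < m →
    (∀ x ∈ Δ j, ∀ t ∈ Δ (j + 1), x ≤ t) ∨ (∀ x ∈ Δ j, ∀ t ∈ Δ (j + 1), t ≤ x)
  ae_notMem_succ : ∀ j, 1 ≤ j → j < m → ∀ᵐ x ∂μ j, x ∉ Δ (j + 1)
  ae_notMem_pred : ∀ j, 1 ≤ j → j < m → ∀ᵐ x ∂μ (j + 1), x ∉ Δ j
  moments : ∀ j, 1 ≤ j → j ≤ m → ∀ n, ∫⁻ x, weight n x ∂μ j ≠ ∞

/-- A `PreSystem` for which all iterated Cauchy transforms of `1` converge absolutely. -/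
structure System (m : ℕ) (μ : ℕ → Measure ℝ) (ε : ℕ → ℝ) (Δ : ℕ → Set ℝ) : Prop
    extends PreSystem m μ ε Δ where
  absCauchy_one : ∀ j l, 1 ≤ j → j + l ≤ m →
    ∫⁻ x, absCauchy μ (fun _ => 1) l (j + 1) x ∂μ j ≠ ∞

lemma weight_mul_inv_le {A B : Set ℝ} (hA : A.Nonempty) (hB : B.Nonempty)
    (h : (∀ x ∈ A, ∀ t ∈ B, x ≤ t) ∨ (∀ x ∈ A, ∀ t ∈ B, t ≤ x)) (n : ℕ) :
    ∃ C : ℝ≥0∞, C ≠ ∞ ∧ ∀ x ∈ A, ∀ t ∈ B,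
      weight n x * ‖(x - t)⁻¹‖ₑ ≤ C * ‖(x - t)⁻¹‖ₑ + weight n x := by
  obtain ⟨a, ha⟩ := hA
  obtain ⟨b, hb⟩ := hB
  -- If |x - t| < 1, then x is bounded by `b` on one side and by `a`, shifted by 1, on the other, so
  -- |x| ≤ |a| + |b| + 1. Otherwise the kernel is at most 1.
  refine ⟨weight n (|a| + |b| + 1), weight_ne_top _ _, fun x hx t ht => ?_⟩
  by_cases h1 : 1 ≤ |x - t|
  · refine le_add_left (mul_le_of_le_one_right' ?_)
    rw [← ofReal_norm, ENNReal.ofReal_le_one, norm_inv, Real.norm_eq_abs]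
    exact inv_le_one_of_one_le₀ h1
  · refine le_add_right (mul_le_mul_left ?_ _)
    unfold weight
    refine pow_le_pow_left' (add_le_add_right ?_ 1) n
    rw [← ofReal_norm, ← ofReal_norm]
    refine ENNReal.ofReal_le_ofReal ?_
    rw [Real.norm_eq_abs, Real.norm_of_nonneg (by positivity)]
    rw [not_le, abs_lt] at h1
    rw [abs_le]
    rcases h with h | h
    · have := h x hx b hb
      have := h a ha t ht
      constructor <;> linarith [neg_abs_le a, le_abs_self b, abs_nonneg a, abs_nonneg b]
    · have := h x hx b hb
      have := h a ha t ht
      constructor <;> linarith [neg_abs_le b, le_abs_self a, abs_nonneg a, abs_nonneg b]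

namespace PreSystem

variable {m : ℕ} {μ : ℕ → Measure ℝ} {ε : ℕ → ℝ} {Δ : ℕ → Set ℝ}

lemma nonempty (S : PreSystem m μ ε Δ) {j : ℕ} (h1 : 1 ≤ j) (h2 : j ≤ m) : (Δ j).Nonempty := by
  by_contra h
  rw [Set.not_nonempty_iff_eq_empty] at h
  refine S.not_finite j h1 h2 ∅ ?_
  filter_upwards [S.ae_mem j h1 h2] with x hx
  simp [h] at hx

end PreSystem

namespace System

variable {m : ℕ} {μ : ℕ → Measure ℝ} {ε : ℕ → ℝ} {Δ : ℕ → Set ℝ} [∀ j, IsFiniteMeasure (μ j)]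

/-- The weight sits next to the innermost kernel. Near the diagonal it is bounded; elsewhere that
kernel is dropped and the weight integrates to a moment, which explains the term with one transform
fewer. -/
lemma absCauchy_weight_le (S : System m μ ε Δ) (n : ℕ) (l : ℕ) :
    ∀ j, 1 ≤ j → j + l + 1 ≤ m → ∃ C : ℝ≥0∞, C ≠ ∞ ∧ ∀ x ∈ Δ j,
      absCauchy μ (weight n) (l + 1) (j + 1) x ≤
        C * (absCauchy μ (fun _ => 1) (l + 1) (j + 1) x +
          absCauchy μ (fun _ => 1) l (j + 1) x) := by
  induction l with
  | zero =>
    intro j hj hm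
    obtain ⟨C, hC, h⟩ := weight_mul_inv_le (S.nonempty (j := j + 1) (by omega) (by omega))
      (S.nonempty hj (by omega)) (A := Δ (j + 1)) (B := Δ j)
      ((S.separated j hj (by omega)).symm.imp (fun h x hx t ht => h t ht x hx)
        (fun h x hx t ht => h t ht x hx)) n
    have hM := S.moments (j + 1) (by omega) (by omega) n
    refine ⟨C + ∫⁻ x, weight n x ∂μ (j + 1), by finiteness, fun x hx => ?_⟩
    simp only [absCauchy, mul_one]
    calc ∫⁻ t, ‖(x - t)⁻¹‖ₑ * weight n t ∂μ (j + 1)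
        ≤ ∫⁻ t, (C * ‖(x - t)⁻¹‖ₑ + weight n t) ∂μ (j + 1) := by
          refine lintegral_mono_ae ?_
          filter_upwards [S.ae_mem (j + 1) (by omega) (by omega)] with t ht
          have := h t ht x hx
          have e : ‖(t - x)⁻¹‖ₑ = ‖(x - t)⁻¹‖ₑ := by
            rw [← neg_sub x t, inv_neg, enorm_neg]
          rwa [e, mul_comm (weight n t)] at this
      _ = C * ∫⁻ t, ‖(x - t)⁻¹‖ₑ ∂μ (j + 1) + ∫⁻ t, weight n t ∂μ (j + 1) := by
          rw [lintegral_add_right _ (measurable_weight n), lintegral_const_mul _ (by fun_prop)]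
      _ ≤ _ := by
          rw [mul_add, mul_one]
          refine add_le_add (mul_le_mul_left le_self_add _) le_add_self
  | succ l ih =>
    intro j hj hm
    obtain ⟨C, hC, h⟩ := ih (j + 1) (by omega) (by omega)
    refine ⟨C, hC, fun x hx => ?_⟩
    have hmeas : Measurable fun t : ℝ => ‖(x - t)⁻¹‖ₑ := by fun_prop
    rw [absCauchy, absCauchy, absCauchy, ← lintegral_add_right, ← lintegral_const_mul]
    · refine lintegral_mono_ae ?_
      filter_upwards [S.ae_mem (j + 1) (by omega) (by omega)] with t ht
      refine (mul_le_mul_right (h t ht) _).trans (le_of_eq ?_)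
      rw [absCauchy]
      ring
    · exact (hmeas.mul (measurable_absCauchy measurable_const _ _)).add
        (hmeas.mul (measurable_absCauchy measurable_const _ _))
    · exact hmeas.mul (measurable_absCauchy measurable_const _ _)

lemma lintegral_absCauchy_weight (S : System m μ ε Δ) (n : ℕ) {j l : ℕ} (hj : 1 ≤ j)
    (hl : j + l ≤ m) : ∫⁻ x, absCauchy μ (weight n) l (j + 1) x ∂μ j ≠ ∞ := by
  cases l with
  | zero => exact S.moments j hj hl n
  | succ l =>
    obtain ⟨C, hC, h⟩ := S.absCauchy_weight_le n l j hj hl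
    have h1 := S.absCauchy_one j (l + 1) hj hl
    have h2 := S.absCauchy_one j l hj (by omega)
    refine ne_top_of_le_ne_top ?_ (lintegral_mono_ae
      ((S.ae_mem j hj (by omega)).mono fun x hx => h x hx))
    rw [lintegral_const_mul, lintegral_add_left]
    · finiteness
    · exact measurable_absCauchy measurable_const _ _
    · exact (measurable_absCauchy measurable_const _ _).add
        (measurable_absCauchy measurable_const _ _)

/-- The same trade at the outermost kernel: dropping it decouples the variables and leaves the
constant `D` times a moment of `μ j`. -/
lemma lintegral_weight_mul_absCauchy (S : System m μ ε Δ) (k n : ℕ) {j l : ℕ} (hj : 1 ≤ j)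
    (hl : j + l ≤ m) : ∫⁻ x, weight k x * absCauchy μ (weight n) l (j + 1) x ∂μ j ≠ ∞ := by
  cases l with
  | zero =>
    simp only [absCauchy, weight, ← pow_add]
    exact S.moments j hj hl (k + n)
  | succ l =>
    obtain ⟨C, hC, h⟩ := weight_mul_inv_le (S.nonempty hj (by omega))
      (S.nonempty (j := j + 1) (by omega) (by omega)) (S.separated j hj (by omega)) k
    set D := ∫⁻ t, absCauchy μ (weight n) l (j + 2) t ∂μ (j + 1) with hD
    have hDt : D ≠ ∞ := S.lintegral_absCauchy_weight n (by omega) (by omega)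
    have key : ∀ x ∈ Δ j, weight k x * absCauchy μ (weight n) (l + 1) (j + 1) x ≤
        C * absCauchy μ (weight n) (l + 1) (j + 1) x + D * weight k x := by
      intro x hx
      have hmeas : Measurable fun t : ℝ => ‖(x - t)⁻¹‖ₑ := by fun_prop
      have hm1 := measurable_absCauchy (μ := μ) (measurable_weight n) l (j + 2)
      have hm2 : Measurable fun t : ℝ => ‖(x - t)⁻¹‖ₑ * absCauchy μ (weight n) l (j + 2) t :=
        hmeas.mul hm1
      rw [absCauchy, ← lintegral_const_mul _ hm2, ← lintegral_const_mul _ hm2, hD, ← lintegral_mul_const _ hm1,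
        ← lintegral_add_right _ (hm1.mul_const _)]
      refine lintegral_mono_ae ?_
      filter_upwards [S.ae_mem (j + 1) (by omega) (by omega)] with t ht
      rw [← mul_assoc, ← mul_assoc, mul_comm _ (weight k x), ← add_mul]
      exact mul_le_mul_left (h x hx t ht) _
    refine ne_top_of_le_ne_top ?_ (lintegral_mono_ae
      ((S.ae_mem j hj (by omega)).mono fun x hx => key x hx))
    have h1 := S.lintegral_absCauchy_weight n hj hl
    have h2 := S.moments j hj (by omega) k
    rw [lintegral_add_right _ ((measurable_weight k).const_mul _), lintegral_const_mul,
      lintegral_const_mul _ (measurable_weight k)]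
    · finiteness
    · exact measurable_absCauchy (measurable_weight n) _ _

/-- Absolute convergence of the iterated integrals of polynomially bounded functions. -/
lemma lintegral_mul_absCauchy (S : System m μ ε Δ) {f g : ℝ → ℝ≥0∞} {C D : ℝ≥0∞} {k n : ℕ}
    (hC : C ≠ ∞) (hD : D ≠ ∞) (hf : ∀ x, f x ≤ C * weight k x) (hg : ∀ x, g x ≤ D * weight n x)
    {j l : ℕ} (hj : 1 ≤ j) (hl : j + l ≤ m) :
    ∫⁻ x, f x * absCauchy μ g l (j + 1) x ∂μ j ≠ ∞ := by
  have h := S.lintegral_weight_mul_absCauchy k n hj hl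
  refine ne_top_of_le_ne_top ?_ (lintegral_mono (g := fun x =>
    (C * D) * (weight k x * absCauchy μ (weight n) l (j + 1) x)) fun x => ?_)
  · rw [lintegral_const_mul]
    · finiteness
    · exact (measurable_weight k).mul (measurable_absCauchy (measurable_weight n) _ _)
  · calc f x * absCauchy μ g l (j + 1) x
        ≤ (C * weight k x) * absCauchy μ (fun y => D * weight n y) l (j + 1) x :=
          mul_le_mul' (hf x) (absCauchy_mono hg _ _ _)
      _ = _ := by rw [absCauchy_const_mul (measurable_weight n)]; ring

end System

/-! ### Sign changes and orthogonality -/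

section Zeros

lemma constSign_of_forall_ne_zero {I : Set ℝ} (hI : I.OrdConnected) {f : ℝ → ℝ}
    (hf : ContinuousOn f I) (h0 : ∀ x ∈ I, f x ≠ 0) :
    (∀ x ∈ I, 0 ≤ f x) ∨ (∀ x ∈ I, f x ≤ 0) := by
  by_contra! h
  obtain ⟨⟨x, hx, hfx⟩, y, hy, hfy⟩ := h
  obtain ⟨z, hz, hfz⟩ := hI.isPreconnected.intermediate_value hx hy hf ⟨hfx.le, hfy.le⟩
  exact h0 z hz hfz

/-- A continuous function with finitely many zeros on an interval is multiplied to a nonnegative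
one by a polynomial with at most as many zeros. -/
lemma exists_polynomial_mul_nonneg {f : ℝ → ℝ} (Z : Finset ℝ) (hZ : ∀ x ∈ Z, f x = 0) :
    ∀ {I : Set ℝ}, I.OrdConnected → ContinuousOn f I → (∀ x ∈ I, f x = 0 → x ∈ Z) →
    ∃ q : ℝ[X], q.natDegree ≤ Z.card ∧ (∀ x, q.eval x = 0 → x ∈ Z) ∧
      ∀ x ∈ I, 0 ≤ f x * q.eval x := by
  induction Z using Finset.induction_on_max with
  | empty =>
    intro I hI hf h
    rcases constSign_of_forall_ne_zero hI hf (fun x hx h' => by simpa using h x hx h') with h | h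
    · exact ⟨1, by simp, by simp, by simpa using h⟩
    · exact ⟨-1, by simp, by simp, by simpa using h⟩
  | insert a s hs ih =>
    intro I hI hf h
    have has : a ∉ s := fun h => (hs a h).false
    obtain ⟨q, hq1, hq2, hq3⟩ := ih (fun x hx => hZ x (by simp [hx]))
      (hI.inter Set.ordConnected_Iio (t := Set.Iio a)) (hf.mono Set.inter_subset_left)
      (fun x hx h0 => by
        have := h x hx.1 h0
        rw [Finset.mem_insert] at this
        exact this.resolve_left hx.2.ne)
    -- Beyond the largest zero `a` the product f q keeps one sign, because the roots of `q` lie in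
    -- `s`, below `a`. If the sign is wrong, the factor a - x flips it there and preserves it to the
    -- left of `a`.
    have hright := constSign_of_forall_ne_zero
      (hI.inter Set.ordConnected_Ioi (t := Set.Ioi a)) (f := fun x => f x * q.eval x)
      ((hf.mono Set.inter_subset_left).mul q.continuous.continuousOn) (by
        rintro x ⟨hx, hax⟩ h0
        have hax : a < x := hax
        rcases mul_eq_zero.1 h0 with h0 | h0
        · rcases Finset.mem_insert.1 (h x hx h0) with h1 | h1
          · exact hax.ne' h1
          · exact (hs x h1).not_gt hax
        · exact (hs x (hq2 x h0)).not_gt hax)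
    have ha : f a = 0 := hZ a (by simp)
    rw [Finset.card_insert_of_notMem has]
    rcases hright with hr | hr
    · refine ⟨q, by omega, fun x hx => by simp [hq2 x hx], fun x hx => ?_⟩
      rcases lt_trichotomy x a with h1 | rfl | h1
      · exact hq3 x ⟨hx, h1⟩
      · simp [ha]
      · exact hr x ⟨hx, h1⟩
    · refine ⟨q * (C a - X), ?_, fun x hx => ?_, fun x hx => ?_⟩
      · refine natDegree_mul_le.trans (add_le_add hq1 ?_)
        exact (natDegree_sub_le _ _).trans (by simp)
      · rw [eval_mul, mul_eq_zero] at hx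
        rcases hx with hx | hx
        · simp [hq2 x hx]
        · simp only [eval_sub, eval_C, eval_X, sub_eq_zero] at hx
          simp [hx]
      · simp only [eval_mul, eval_sub, eval_C, eval_X, ← mul_assoc]
        rcases lt_trichotomy x a with h1 | rfl | h1
        · exact mul_nonneg (hq3 x ⟨hx, h1⟩) (by linarith)
        · simp
        · exact mul_nonneg_of_nonpos_of_nonpos (hr x ⟨hx, h1⟩) (by linarith)

/-- A continuous function orthogonal to all polynomials of degree at most `N` has at least `N + 1`
zeros. -/
lemma exists_zeros_of_orthogonal {ν : Measure ℝ} {I : Set ℝ} (hI : I.OrdConnected)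
    (hmem : ∀ᵐ x ∂ν, x ∈ I) (hfin : ∀ s : Finset ℝ, ¬ ∀ᵐ x ∂ν, x ∈ s) {f : ℝ → ℝ}
    (hf : ContinuousOn f I) {N : ℕ}
    (hint : ∀ q : ℝ[X], q.natDegree ≤ N →
      Integrable (fun x => f x * q.eval x) ν ∧ ∫ x, f x * q.eval x ∂ν = 0) :
    ∃ Z : Finset ℝ, Z.card = N + 1 ∧ ∀ x ∈ Z, x ∈ I ∧ f x = 0 := by
  by_cases hA : {x | x ∈ I ∧ f x = 0}.Finite
  · by_cases hc : N + 1 ≤ hA.toFinset.card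
    · obtain ⟨Z, hZ, hZc⟩ := Finset.exists_subset_card_eq hc
      exact ⟨Z, hZc, fun x hx => by simpa using hZ hx⟩
    · obtain ⟨q, hq1, hq2, hq3⟩ := exists_polynomial_mul_nonneg (f := f) hA.toFinset
        (fun x hx => by simp at hx; exact hx.2) hI hf (fun x hx h0 => by simp [hx, h0])
      -- With at most N zeros, `q` is an admissible test polynomial; as f q ≥ 0 has integral 0, the
      -- measure would live on the finite zero set.
      obtain ⟨h1, h2⟩ := hint q (by omega)
      rw [integral_eq_zero_iff_of_nonneg_ae (hmem.mono fun x hx => hq3 x hx) h1] at h2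
      refine (hfin hA.toFinset ?_).elim
      filter_upwards [h2, hmem] with x hx hxI
      rcases mul_eq_zero.1 hx with h0 | h0
      · simp [hxI, h0]
      · exact hq2 x h0
  · obtain ⟨Z, hZ, hZc⟩ := Set.Infinite.exists_subset_card_eq hA (N + 1)
    exact ⟨Z, hZc, fun x hx => hZ hx⟩

end Zeros

/-! ### Cauchy integrals off a closed carrier; functions of polynomial growth -/

section CauchyIntegrals

variable {E : Type*} [NormedAddCommGroup E] [NormedSpace ℝ E]

lemma exists_pos_le_abs_sub {A : Set ℝ} (hA : IsClosed A) {z : ℝ} (hz : z ∉ A) :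
    ∃ δ > 0, ∀ x, |x - z| < δ → ∀ t ∈ A, δ ≤ |x - t| := by
  obtain ⟨r, hr, h⟩ := Metric.isOpen_iff.1 hA.isOpen_compl z hz
  refine ⟨r / 2, by positivity, fun x hx t ht => ?_⟩
  by_contra! h1
  refine h (a := t) ?_ ht
  rw [Metric.mem_ball, Real.dist_eq]
  calc |t - z| ≤ |t - x| + |x - z| := abs_sub_le _ _ _
    _ < r := by rw [abs_sub_comm t x]; linarith

lemma integrable_inv_sub_smul {ν : Measure ℝ} {A : Set ℝ} (hA : IsClosed A)
    (hmem : ∀ᵐ x ∂ν, x ∈ A) {z : ℝ} (hz : z ∉ A) {F : ℝ → E} (hF : Integrable F ν) :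
    Integrable (fun t => (z - t)⁻¹ • F t) ν := by
  obtain ⟨δ, hδ, h⟩ := exists_pos_le_abs_sub hA hz
  refine (hF.norm.const_mul δ⁻¹).mono' ((by fun_prop : Measurable fun t : ℝ =>
    (z - t)⁻¹).aestronglyMeasurable.smul hF.aestronglyMeasurable) ?_
  filter_upwards [hmem] with t ht
  rw [norm_smul, norm_inv, Real.norm_eq_abs]
  gcongr
  exact h z (by simpa) t ht

lemma continuousAt_cauchy_integral {ν : Measure ℝ} {A : Set ℝ} (hA : IsClosed A)
    (hmem : ∀ᵐ x ∂ν, x ∈ A) {z : ℝ} (hz : z ∉ A) {F : ℝ → E} (hF : Integrable F ν) :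
    ContinuousAt (fun x => ∫ t, (x - t)⁻¹ • F t ∂ν) z := by
  obtain ⟨δ, hδ, h⟩ := exists_pos_le_abs_sub hA hz
  have hev : ∀ᶠ x in 𝓝 z, |x - z| < δ := Metric.ball_mem_nhds z hδ
  refine continuousAt_of_dominated (bound := fun t => δ⁻¹ * ‖F t‖) ?_ ?_ (hF.norm.const_mul _) ?_
  · exact Eventually.of_forall fun x => ((by fun_prop : Measurable fun t : ℝ =>
      (x - t)⁻¹).aestronglyMeasurable.smul hF.aestronglyMeasurable)
  · filter_upwards [hev] with x hx
    filter_upwards [hmem] with t ht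
    rw [norm_smul, norm_inv, Real.norm_eq_abs]
    gcongr
    exact h x hx t ht
  · filter_upwards [hmem] with t ht
    have : z - t ≠ 0 := sub_ne_zero.2 (ne_of_mem_of_not_mem ht hz).symm
    fun_prop (disch := assumption)

/-- Measurable functions of polynomial growth. -/
structure Tame (g : ℝ → E) : Prop where
  stronglyMeasurable : StronglyMeasurable g
  bound : ∃ (C : ℝ≥0∞) (n : ℕ), C ≠ ∞ ∧ ∀ x, ‖g x‖ₑ ≤ C * weight n x

lemma tame_one : Tame (fun _ => (1 : ℝ)) :=
  ⟨stronglyMeasurable_const, 1, 0, by simp, by simp⟩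

lemma tame_complex (p : ℂ[X]) : Tame (fun x : ℝ => p.eval (x : ℂ)) := by
  obtain ⟨C, hC, h⟩ := enorm_eval_le_weight p le_rfl
  exact ⟨(p.continuous.comp Complex.continuous_ofReal).stronglyMeasurable, C, _, hC, h⟩

lemma tame_real (p : ℝ[X]) : Tame (fun x : ℝ => p.eval x) := by
  obtain ⟨C, hC, h⟩ := enorm_eval_le_weight (p.map (algebraMap ℝ ℂ)) le_rfl
  refine ⟨p.continuous.stronglyMeasurable, C, (p.map (algebraMap ℝ ℂ)).natDegree, hC, fun x => ?_⟩
  have := h x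
  rw [← Complex.coe_algebraMap, eval_map_apply, Complex.coe_algebraMap] at this
  simpa [← ofReal_norm] using this

end CauchyIntegrals

namespace System

variable {m : ℕ} {μ : ℕ → Measure ℝ} {ε : ℕ → ℝ} {Δ : ℕ → Set ℝ} [∀ j, IsFiniteMeasure (μ j)]
  {E : Type*} [NormedAddCommGroup E] [NormedSpace ℝ E]

lemma integrable_smul_iterCauchy (S : System m μ ε Δ) {𝕜 : Type*} [NormedField 𝕜] [NormedSpace 𝕜 E]
    {f : ℝ → 𝕜} {g : ℝ → E} (hf : Tame f) (hg : Tame g) {j l : ℕ} (hj : 1 ≤ j) (hl : j + l ≤ m) :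
    Integrable (fun x => f x • iterCauchy μ ε g l (j + 1) x) (μ j) := by
  obtain ⟨C, k, hC, hCf⟩ := hf.bound
  obtain ⟨D, n, hD, hDg⟩ := hg.bound
  refine ⟨(hf.stronglyMeasurable.smul
    (stronglyMeasurable_iterCauchy hg.stronglyMeasurable _ _)).aestronglyMeasurable, ?_⟩
  refine lt_of_le_of_lt (lintegral_mono fun x => ?_)
    (S.lintegral_mul_absCauchy hC hD hCf hDg hj hl).lt_top
  rw [enorm_smul]
  exact mul_le_mul_right (enorm_iterCauchy_le S.sign _ _ _ _) _

lemma integrable_iterCauchy (S : System m μ ε Δ) {g : ℝ → E} (hg : Tame g) {j l : ℕ}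
    (hj : 1 ≤ j) (hl : j + l ≤ m) : Integrable (iterCauchy μ ε g l (j + 1)) (μ j) := by
  simpa using S.integrable_smul_iterCauchy tame_one hg hj hl

end System

/-! ### Counting zeros of iterated transforms -/

/-- The interval `Δ_j` without the point it may share with `Δ_{j+1}`. -/
def gapInterval (m : ℕ) (Δ : ℕ → Set ℝ) (j : ℕ) : Set ℝ := {x | x ∈ Δ j ∧ (j < m → x ∉ Δ (j + 1))}

/-- Consecutive intervals lie on opposite sides of a common point, so removing that point removes an
endpoint and does not split the interval. -/
lemma PreSystem.ordConnected_gapInterval {m : ℕ} {μ : ℕ → Measure ℝ} {ε : ℕ → ℝ} {Δ : ℕ → Set ℝ}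
    (S : PreSystem m μ ε Δ) {j : ℕ} (h1 : 1 ≤ j) (h2 : j ≤ m) :
    (gapInterval m Δ j).OrdConnected := by
  refine ⟨fun x hx z hz y hy => ⟨(S.ordConnected j h1 h2).out hx.1 hz.1 hy, fun hm hyΔ => ?_⟩⟩
  rcases S.separated j h1 hm with h | h
  · exact hz.2 hm (le_antisymm hy.2 (h z hz.1 y hyΔ) ▸ hyΔ)
  · exact hx.2 hm (le_antisymm (h x hx.1 y hyΔ) hy.1 ▸ hyΔ)

lemma PreSystem.ae_mem_gapInterval {m : ℕ} {μ : ℕ → Measure ℝ} {ε : ℕ → ℝ} {Δ : ℕ → Set ℝ}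
    (S : PreSystem m μ ε Δ) {j : ℕ} (h1 : 1 ≤ j) (h2 : j ≤ m) :
    ∀ᵐ x ∂μ j, x ∈ gapInterval m Δ j := by
  by_cases hm : j < m
  · filter_upwards [S.ae_mem j h1 h2, S.ae_notMem_succ j h1 hm] with x h h' using ⟨h, fun _ => h'⟩
  · filter_upwards [S.ae_mem j h1 h2] with x h using ⟨h, fun h' => (hm h').elim⟩

namespace System

variable {m : ℕ} {μ : ℕ → Measure ℝ} {ε : ℕ → ℝ} {Δ : ℕ → Set ℝ} [∀ j, IsFiniteMeasure (μ j)]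
  {E : Type*} [NormedAddCommGroup E] [NormedSpace ℝ E]

lemma continuousOn_iterCauchy_real (S : System m μ ε Δ) (p : ℝ[X]) {j l : ℕ}
    (hj : 1 ≤ j) (hl : j + l = m) :
    ContinuousOn (iterCauchy μ ε (fun x => p.eval x) l (j + 1)) (gapInterval m Δ j) := by
  cases l with
  | zero => exact p.continuous.continuousOn
  | succ l =>
    intro x hx
    refine ContinuousAt.continuousWithinAt ?_
    exact (continuousAt_cauchy_integral (S.isClosed (j + 1) (by omega) (by omega))
      (S.ae_mem (j + 1) (by omega) (by omega)) (hx.2 (by omega))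
      (S.integrable_iterCauchy (tame_real p) (by omega) (by omega))).const_smul (ε (j + 1))

/-- The iterated transforms of a polynomial of degree at most `N` have at most `N` zeros. -/
lemma card_zeros_iterCauchy_le (S : System m μ ε Δ) {p : ℝ[X]} (hp : p ≠ 0) {N : ℕ}
    (hN : p.natDegree ≤ N) (l : ℕ) : ∀ j, 1 ≤ j → j + l = m → ∀ Z : Finset ℝ,
      (∀ x ∈ Z, x ∈ gapInterval m Δ j ∧ iterCauchy μ ε (fun x => p.eval x) l (j + 1) x = 0) →
      Z.card ≤ N := by
  induction l with
  | zero =>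
    intro j _ _ Z hZ
    refine le_trans ?_ hN
    exact p.card_le_degree_of_subset_roots fun x hx =>
      (mem_roots hp).2 (hZ x (by simpa using hx)).2
  | succ l ih =>
    intro j hj hl Z hZ
    by_contra! hc
    obtain ⟨Z', hZ', hc'⟩ := Finset.exists_subset_card_eq hc
    set F := iterCauchy μ ε (fun x => p.eval x) l (j + 2) with hF
    have hcl := S.isClosed (j + 1) (by omega) (by omega)
    have hmem := S.ae_mem (j + 1) (by omega) (by omega)
    have hFi : Integrable F (μ (j + 1)) :=
      S.integrable_iterCauchy (tame_real p) (by omega) (by omega)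
    have hout : ∀ z ∈ Z', z ∉ Δ (j + 1) := fun z hz => (hZ z (hZ' hz)).1.2 (by omega)
    -- Each of the N + 1 assumed zeros is a linear condition on `F`, the transform one level further
    -- in.
    have hzi : ∀ z ∈ Z', Integrable (fun t => (t - z)⁻¹ * F t) (μ (j + 1)) ∧
        ∫ t, (t - z)⁻¹ * F t ∂μ (j + 1) = 0 := by
      intro z hz
      have e : (fun t => (t - z)⁻¹ * F t) = fun t => -((z - t)⁻¹ • F t) := by
        ext t
        rw [← neg_sub z t, inv_neg, neg_mul, smul_eq_mul]
      have h0 := (hZ z (hZ' hz)).2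
      rw [iterCauchy, smul_eq_zero] at h0
      have hε : ε (j + 1) ≠ 0 := by rcases S.sign (j + 1) with h | h <;> simp [h]
      rw [e, integral_neg, h0.resolve_left hε, neg_zero]
      exact ⟨(integrable_inv_sub_smul hcl hmem (hout z hz) hFi).neg, rfl⟩
    have hnod : ∀ t ∈ Δ (j + 1), (Lagrange.nodal Z' id).eval t ≠ 0 := fun t ht h0 => by
      rw [Lagrange.eval_nodal, Finset.prod_eq_zero_iff] at h0
      obtain ⟨z, hz, h0⟩ := h0
      exact hout z hz ((sub_eq_zero.1 h0 : t = z) ▸ ht)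
    obtain ⟨Y, hYc, hY⟩ := exists_zeros_of_orthogonal (N := N)
      (S.ordConnected_gapInterval (j := j + 1) (by omega) (by omega))
      (S.ae_mem_gapInterval (by omega) (by omega)) (S.not_finite (j + 1) (by omega) (by omega))
      (f := fun t => F t * ((Lagrange.nodal Z' id).eval t)⁻¹)
      ((S.continuousOn_iterCauchy_real p (by omega) (by omega)).mul
        ((Lagrange.nodal Z' id).continuous.continuousOn.inv₀ fun t ht => hnod t ht.1)) (by
      intro q hq
      -- Partial fractions of q/ω, where ω is the nodal polynomial of the N + 1 points of `Z'` and
      -- deg q ≤ N. Thus F/ω is orthogonal to every such `q`, so `F` has N + 1 zeros, against the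
      -- induction hypothesis.
      have hqe : (fun t => F t * ((Lagrange.nodal Z' id).eval t)⁻¹ * q.eval t) =ᵐ[μ (j + 1)]
          fun t => ∑ z ∈ Z', Lagrange.nodalWeight Z' id z * q.eval z * ((t - z)⁻¹ * F t) := by
        filter_upwards [hmem] with t ht
        have hI := Lagrange.eq_interpolate (s := Z') (v := id) (f := q)
          (fun _ _ _ _ h => h) (by
            rw [hc']
            exact degree_le_natDegree.trans_lt (by exact_mod_cast Nat.lt_succ_of_le hq))
        have hv := Lagrange.eval_interpolate_not_at_node (s := Z') (v := id) (x := t)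
          (fun z => q.eval z) (fun z hz h => hout z hz ((show t = z from h) ▸ ht))
        have hqt : q.eval t = (Lagrange.nodal Z' id).eval t *
            ∑ z ∈ Z', Lagrange.nodalWeight Z' id z * (t - id z)⁻¹ * q.eval z := by
          rw [← hv]
          exact congrArg (eval t) hI
        rw [hqt, mul_assoc, inv_mul_cancel_left₀ (hnod t ht), Finset.mul_sum]
        refine Finset.sum_congr rfl fun z _ => ?_
        simp only [id]
        ring
      refine ⟨(integrable_congr hqe).2 (integrable_finsetSum _ fun z hz =>
        (hzi z hz).1.const_mul _), ?_⟩
      rw [integral_congr_ae hqe, integral_finsetSum _ fun z hz => (hzi z hz).1.const_mul _]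
      refine Finset.sum_eq_zero fun z hz => ?_
      rw [integral_const_mul, (hzi z hz).2, mul_zero])
    have := ih (j + 1) (by omega) (by omega) Y fun x hx => by
      obtain ⟨h1, h2⟩ := hY x hx
      exact ⟨h1, (mul_eq_zero.1 h2).resolve_right (inv_ne_zero (hnod x h1.1))⟩
    omega

/-- Nondegeneracy of the pairing defined by the Cauchy convolution kernel. -/
lemma eq_zero_of_orthogonal_real (S : System m μ ε Δ) (hm : 1 ≤ m) {p : ℝ[X]} {N : ℕ}
    (hN : p.natDegree ≤ N)
    (h : ∀ i ≤ N, ∫ x, x ^ i * iterCauchy μ ε (fun x => p.eval x) (m - 1) 2 x ∂μ 1 = 0) :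
    p = 0 := by
  by_contra hp
  set F := iterCauchy μ ε (fun x => p.eval x) (m - 1) 2 with hF
  have hint : ∀ i : ℕ, Integrable (fun x => x ^ i * F x) (μ 1) := fun i => by
    simpa using S.integrable_smul_iterCauchy (tame_real (X ^ i)) (tame_real p) le_rfl
      (l := m - 1) (by omega)
  obtain ⟨Z, hZc, hZ⟩ := exists_zeros_of_orthogonal (N := N)
    (S.ordConnected_gapInterval le_rfl hm) (S.ae_mem_gapInterval le_rfl hm)
    (S.not_finite 1 le_rfl hm) (f := F) (S.continuousOn_iterCauchy_real p le_rfl (by omega)) (by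
      intro q hq
      have e : (fun x => F x * q.eval x) =
          fun x => ∑ i ∈ Finset.range (N + 1), q.coeff i * (x ^ i * F x) := by
        ext x
        rw [eval_eq_sum_range' (Nat.lt_succ_of_le hq), Finset.mul_sum]
        exact Finset.sum_congr rfl fun i _ => by ring
      rw [e, integral_finsetSum _ fun i _ => (hint i).const_mul _]
      refine ⟨integrable_finsetSum _ fun i _ => (hint i).const_mul _,
        Finset.sum_eq_zero fun i hi => ?_⟩
      rw [integral_const_mul, h i (by simp at hi; omega), mul_zero])
  have := S.card_zeros_iterCauchy_le hp hN (m - 1) 1 le_rfl (by omega) Z hZ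
  omega

end System

/-! ### Reversing the order of the measures -/

section Reversal

lemma lintegral_cauchy_swap {ν ν' : Measure ℝ} [SFinite ν] [SFinite ν'] {A B : ℝ → ℝ≥0∞}
    (hA : Measurable A) (hB : Measurable B) :
    ∫⁻ x, A x * ∫⁻ t, ‖(x - t)⁻¹‖ₑ * B t ∂ν' ∂ν =
      ∫⁻ t, (∫⁻ x, ‖(t - x)⁻¹‖ₑ * A x ∂ν) * B t ∂ν' := by
  have hk : Measurable fun p : ℝ × ℝ => ‖(p.1 - p.2)⁻¹‖ₑ := measurable_inv_sub.enorm
  have h1 : ∀ x, A x * ∫⁻ t, ‖(x - t)⁻¹‖ₑ * B t ∂ν' =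
      ∫⁻ t, A x * (‖(x - t)⁻¹‖ₑ * B t) ∂ν' := fun x =>
    (lintegral_const_mul _ ((hk.comp measurable_prodMk_left).mul hB)).symm
  have h2 : ∀ t, (∫⁻ x, ‖(t - x)⁻¹‖ₑ * A x ∂ν) * B t =
      ∫⁻ x, A x * (‖(x - t)⁻¹‖ₑ * B t) ∂ν := fun t => by
    have hm : Measurable fun x => ‖(t - x)⁻¹‖ₑ * A x := (hk.comp measurable_prodMk_left).mul hA
    rw [← lintegral_mul_const _ hm]
    refine lintegral_congr fun x => ?_
    rw [← neg_sub x t, inv_neg, enorm_neg]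
    ring
  simp_rw [h1, h2]
  refine lintegral_lintegral_swap (Measurable.aemeasurable ?_)
  exact (hA.comp measurable_fst).mul (hk.mul (hB.comp measurable_snd))

lemma integral_cauchy_swap {ν ν' : Measure ℝ} [SFinite ν] [SFinite ν'] {A B : ℝ → ℂ}
    (hA : StronglyMeasurable A) (hB : StronglyMeasurable B)
    (h : ∫⁻ x, ‖A x‖ₑ * ∫⁻ t, ‖(x - t)⁻¹‖ₑ * ‖B t‖ₑ ∂ν' ∂ν ≠ ∞) :
    ∫ x, A x * ∫ t, (x - t)⁻¹ • B t ∂ν' ∂ν =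
      -∫ t, (∫ x, (t - x)⁻¹ • A x ∂ν) * B t ∂ν' := by
  have hk : Measurable fun p : ℝ × ℝ => (p.1 - p.2)⁻¹ := measurable_inv_sub
  have h1 : ∀ x, A x * ∫ t, (x - t)⁻¹ • B t ∂ν' = ∫ t, A x * ((x - t)⁻¹ • B t) ∂ν' := fun x =>
    (integral_const_mul _ _).symm
  have h2 : ∀ t, -((∫ x, (t - x)⁻¹ • A x ∂ν) * B t) = ∫ x, A x * ((x - t)⁻¹ • B t) ∂ν := fun t => by
    rw [← neg_mul, ← integral_neg, ← integral_mul_const]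
    refine integral_congr_ae (Eventually.of_forall fun x => ?_)
    simp only
    rw [← neg_sub x t, inv_neg, neg_smul, neg_neg, smul_mul_assoc, mul_smul_comm]
  rw [← integral_neg]
  simp_rw [h1, h2]
  refine integral_integral_swap ⟨StronglyMeasurable.aestronglyMeasurable ?_, ?_⟩
  · exact (hA.comp_measurable measurable_fst).mul
      (hk.stronglyMeasurable.smul (hB.comp_measurable measurable_snd))
  · rw [hasFiniteIntegral_iff_enorm, lintegral_prod]
    · refine lt_of_eq_of_lt (lintegral_congr fun x => ?_) h.lt_top
      rw [← lintegral_const_mul]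
      · exact lintegral_congr fun t => (enorm_mul _ _).trans
          (congrArg _ (enorm_smul _ _))
      · exact (hk.enorm.comp measurable_prodMk_left).mul hB.enorm
    · exact ((hA.comp_measurable measurable_fst).mul
        (hk.stronglyMeasurable.smul (hB.comp_measurable measurable_snd))).enorm.aemeasurable

/-- The family `f_m, …, f_1`. -/
abbrev rev {α : Type*} (m : ℕ) (f : ℕ → α) : ℕ → α := fun j => f (m + 1 - j)

variable {m : ℕ} {μ : ℕ → Measure ℝ} {ε : ℕ → ℝ} {Δ : ℕ → Set ℝ} [∀ j, IsFiniteMeasure (μ j)]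

/-- Each induction step moves the kernel linking `μ j` and `μ (j + 1)` from the right factor to the
left one by Tonelli. The relation k + j = m + 2 makes `μ j` the next measure absorbed by the
reversed transform. -/
lemma lintegral_absCauchy_mul_absCauchy {f g : ℝ → ℝ≥0∞} (hf : Measurable f) (hg : Measurable g)
    (l : ℕ) : ∀ i j k, j + l ≤ m → k + j = m + 2 →
    ∫⁻ x, absCauchy (rev m μ) f i k x * absCauchy μ g l (j + 1) x ∂μ j =
      ∫⁻ x, absCauchy (rev m μ) f (i + l) (k - l) x * g x ∂μ (j + l) := by
  induction l with
  | zero => intro i j k _ _; rfl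
  | succ l ih =>
    intro i j k hl hk
    obtain ⟨k, rfl⟩ : ∃ k', k = k' + 1 := ⟨k - 1, by omega⟩
    have h1 := ih (i + 1) (j + 1) k (by omega) (by omega)
    rw [show i + 1 + l = i + (l + 1) by omega, show j + 1 + l = j + (l + 1) by omega,
      show k - l = k + 1 - (l + 1) by omega] at h1
    rw [← h1]
    have hk' : rev m μ k = μ j := by simp only [rev]; congr 1; omega
    simp only [absCauchy]
    rw [hk']
    exact lintegral_cauchy_swap (measurable_absCauchy (μ := rev m μ) hf _ _)
      (measurable_absCauchy hg _ _)

/-- Signed version of the same transfer: antisymmetry of the kernel costs -1 per step, and the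
finiteness needed for Fubini is carried along by `lintegral_cauchy_swap`. -/
lemma integral_iterCauchy_mul_iterCauchy {f g : ℝ → ℂ} (hf : StronglyMeasurable f)
    (hg : StronglyMeasurable g) (hε : ∀ j, ε j = 1 ∨ ε j = -1) (l : ℕ) :
    ∀ i j k, j + l ≤ m → k + j = m + 2 →
    ∫⁻ x, absCauchy (rev m μ) (fun x => ‖f x‖ₑ) i k x *
      absCauchy μ (fun x => ‖g x‖ₑ) l (j + 1) x ∂μ j ≠ ∞ →
    ε j • ∫ x, iterCauchy (rev m μ) (rev m ε) f i k x * iterCauchy μ ε g l (j + 1) x ∂μ j =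
      (-1) ^ l * ε (j + l) •
        ∫ x, iterCauchy (rev m μ) (rev m ε) f (i + l) (k - l) x * g x ∂μ (j + l) := by
  induction l with
  | zero => intro i j k _ _ _; simp [iterCauchy]
  | succ l ih =>
    intro i j k hl hk hfin
    obtain ⟨k, rfl⟩ : ∃ k', k = k' + 1 := ⟨k - 1, by omega⟩
    have hk' : rev m μ k = μ j := by simp only [rev]; congr 1; omega
    have hk'' : rev m ε k = ε j := by simp only [rev]; congr 1; omega
    have hmf := measurable_absCauchy (μ := rev m μ) hf.enorm i (k + 1)
    have hmg := measurable_absCauchy (μ := μ) hg.enorm l (j + 2)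
    have h1 := ih (i + 1) (j + 1) k (by omega) (by omega) (by
      simp only [absCauchy] at hfin ⊢
      rwa [lintegral_cauchy_swap hmf hmg, ← hk'] at hfin)
    rw [show i + 1 + l = i + (l + 1) by omega, show j + 1 + l = j + (l + 1) by omega,
      show k - l = k + 1 - (l + 1) by omega] at h1
    rw [pow_succ', mul_assoc, ← h1]
    simp only [iterCauchy]
    rw [hk', hk'']
    have h2 := integral_cauchy_swap (ν := μ j) (ν' := μ (j + 1))
      (stronglyMeasurable_iterCauchy (μ := rev m μ) (ε := rev m ε) hf i (k + 1))
      (stronglyMeasurable_iterCauchy (μ := μ) (ε := ε) hg l (j + 2)) (by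
        refine ne_top_of_le_ne_top hfin (lintegral_mono fun x => ?_)
        refine mul_le_mul' (enorm_iterCauchy_le (fun j => hε _) _ _ _ _) ?_
        exact lintegral_mono fun t => mul_le_mul_right (enorm_iterCauchy_le hε _ _ _ _) _)
    simp_rw [mul_smul_comm, smul_mul_assoc, integral_smul]
    rw [h2, smul_comm]
    simp only [smul_neg, neg_one_mul]

omit [∀ j, IsFiniteMeasure (μ j)] in
lemma PreSystem.reverse (S : PreSystem m μ ε Δ) :
    PreSystem m (rev m μ) (rev m ε) (rev m Δ) where
  sign j := S.sign _
  isClosed j h1 h2 := S.isClosed _ (by omega) (by omega)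
  ordConnected j h1 h2 := S.ordConnected _ (by omega) (by omega)
  ae_mem j h1 h2 := S.ae_mem _ (by omega) (by omega)
  not_finite j h1 h2 := S.not_finite _ (by omega) (by omega)
  separated j h1 h2 := by
    have h := S.separated (m - j) (by omega) (by omega)
    simp only [rev]
    rw [show m + 1 - j = m - j + 1 by omega, show m + 1 - (j + 1) = m - j by omega]
    exact h.symm.imp (fun h x hx t ht => h t ht x hx) (fun h x hx t ht => h t ht x hx)
  ae_notMem_succ j h1 h2 := by
    have h := S.ae_notMem_pred (m - j) (by omega) (by omega)
    simp only [rev]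
    rwa [show m + 1 - j = m - j + 1 by omega, show m + 1 - (j + 1) = m - j by omega]
  ae_notMem_pred j h1 h2 := by
    have h := S.ae_notMem_succ (m - j) (by omega) (by omega)
    simp only [rev]
    rwa [show m + 1 - j = m - j + 1 by omega, show m + 1 - (j + 1) = m - j by omega]
  moments j h1 h2 := S.moments _ (by omega) (by omega)

/-- By Tonelli the absolute iterated integral of 1 is the same from either end of a block of
consecutive measures. -/
lemma System.reverse (S : System m μ ε Δ) : System m (rev m μ) (rev m ε) (rev m Δ) where
  toPreSystem := S.toPreSystem.reverse
  absCauchy_one j l h1 h2 := by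
    have h := S.absCauchy_one (m + 1 - (j + l)) l (by omega) (by omega)
    have e := lintegral_absCauchy_mul_absCauchy (m := m) (μ := μ) (f := fun _ => 1)
      (g := fun _ => 1) measurable_const measurable_const l 0 (m + 1 - (j + l)) (j + l + 1)
      (by omega) (by omega)
    simp only [absCauchy, one_mul, mul_one, zero_add] at e
    rw [show j + l + 1 - l = j + 1 by omega, show m + 1 - (j + l) + l = m + 1 - j by omega] at e
    rwa [e] at h

end Reversal

/-! ### The bilinear form and its nondegeneracy -/

section Pairing

variable {m : ℕ} {μ : ℕ → Measure ℝ} {ε : ℕ → ℝ} {Δ : ℕ → Set ℝ} [∀ j, IsFiniteMeasure (μ j)]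

/-- The pairing of polynomials with respect to the Cauchy convolution kernel, as an iterated
integral. -/
def bilin (m : ℕ) (μ : ℕ → Measure ℝ) (ε : ℕ → ℝ) (q p : ℂ[X]) : ℂ :=
  ε 1 • ∫ x : ℝ, q.eval (x : ℂ) * iterCauchy μ ε (fun y : ℝ => p.eval (y : ℂ)) (m - 1) 2 x ∂μ 1

namespace System

lemma bilin_comm (S : System m μ ε Δ) (hm : 1 ≤ m) (q p : ℂ[X]) :
    bilin m μ ε q p = (-1) ^ (m - 1) * bilin m (rev m μ) (rev m ε) p q := by
  obtain ⟨C, k, hC, hq⟩ := (tame_complex q).bound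
  obtain ⟨D, n, hD, hp⟩ := (tame_complex p).bound
  have h := integral_iterCauchy_mul_iterCauchy (m := m) (μ := μ) (ε := ε)
    (tame_complex q).stronglyMeasurable (tame_complex p).stronglyMeasurable S.sign (m - 1) 0 1
    (m + 1) (by omega) (by omega)
    (S.lintegral_mul_absCauchy hC hD hq hp le_rfl (by omega))
  rw [show m + 1 - (m - 1) = 2 by omega, show 1 + (m - 1) = m by omega, zero_add] at h
  refine h.trans ?_
  simp only [bilin, rev, Nat.add_sub_cancel, mul_comm]

lemma integrable_bilin (S : System m μ ε Δ) (hm : 1 ≤ m) (q p : ℂ[X]) :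
    Integrable (fun x : ℝ => q.eval (x : ℂ) *
      iterCauchy μ ε (fun y : ℝ => p.eval (y : ℂ)) (m - 1) 2 x) (μ 1) :=
  S.integrable_smul_iterCauchy (tame_complex q) (tame_complex p) le_rfl (by omega)

lemma bilin_eq_sum (S : System m μ ε Δ) (hm : 1 ≤ m) (q p : ℂ[X]) {n : ℕ} (hq : q.natDegree ≤ n) :
    bilin m μ ε q p = ∑ i ∈ Finset.range (n + 1), q.coeff i * bilin m μ ε (X ^ i) p := by
  simp only [bilin, mul_smul_comm]
  rw [← Finset.smul_sum]
  congr 1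
  simp_rw [← integral_const_mul]
  rw [← integral_finsetSum _ fun i _ => (S.integrable_bilin hm (X ^ i) p).const_mul _]
  refine integral_congr_ae (Eventually.of_forall fun x => ?_)
  simp only
  rw [eval_eq_sum_range' (Nat.lt_succ_of_le hq), Finset.sum_mul]
  exact Finset.sum_congr rfl fun i _ => by rw [eval_pow, eval_X, mul_assoc]

end System

/-- The real polynomial whose coefficients are the images of those of `p` under `L`. -/
def mapCoeff (L : ℂ →L[ℝ] ℝ) (p : ℂ[X]) : ℝ[X] :=
  ∑ i ∈ Finset.range (p.natDegree + 1), C (L (p.coeff i)) * X ^ i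

lemma natDegree_mapCoeff_le (L : ℂ →L[ℝ] ℝ) (p : ℂ[X]) :
    (mapCoeff L p).natDegree ≤ p.natDegree :=
  natDegree_sum_le_of_forall_le _ _ fun i hi =>
    (natDegree_C_mul_X_pow_le _ _).trans (by simp at hi; omega)

lemma eval_mapCoeff (L : ℂ →L[ℝ] ℝ) (p : ℂ[X]) (x : ℝ) :
    (mapCoeff L p).eval x = L (p.eval (x : ℂ)) := by
  rw [mapCoeff, eval_finsetSum, eval_eq_sum_range (p := p), map_sum]
  refine Finset.sum_congr rfl fun i _ => ?_
  rw [← Complex.ofReal_pow, mul_comm (p.coeff i), ← Complex.real_smul, map_smul,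
    eval_C_mul, eval_pow, eval_X, smul_eq_mul, mul_comm]

lemma coeff_mapCoeff (L : ℂ →L[ℝ] ℝ) (p : ℂ[X]) : (mapCoeff L p).coeff p.natDegree =
    L p.leadingCoeff := by
  rw [mapCoeff, finsetSum_coeff, Finset.sum_eq_single p.natDegree]
  · rw [coeff_C_mul_X_pow, if_pos rfl, leadingCoeff]
  · intro i _ hi
    rw [coeff_C_mul_X_pow, if_neg hi.symm]
  · simp

namespace System

lemma map_iterCauchy (S : System m μ ε Δ) (L : ℂ →L[ℝ] ℝ) {g : ℝ → ℂ} (hg : Tame g) (l : ℕ) :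
    ∀ j, 1 ≤ j → j + l ≤ m → ∀ x ∈ gapInterval m Δ j,
      L (iterCauchy μ ε g l (j + 1) x) = iterCauchy μ ε (fun y => L (g y)) l (j + 1) x := by
  induction l with
  | zero => intro j _ _ x _; rfl
  | succ l ih =>
    intro j hj hl x hx
    rw [iterCauchy, iterCauchy, map_smul, ← L.integral_comp_comm]
    · congr 1
      refine integral_congr_ae ?_
      filter_upwards [S.ae_mem_gapInterval (j := j + 1) (by omega) (by omega)] with t ht
      rw [map_smul, ih (j + 1) (by omega) (by omega) t ht]
    · exact integrable_inv_sub_smul (S.isClosed (j + 1) (by omega) (by omega))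
        (S.ae_mem _ (by omega) (by omega)) (hx.2 (by omega))
        (S.integrable_iterCauchy hg (by omega) (by omega))

/-- A polynomial of degree at most `N` which is orthogonal to `1, x, …, x ^ N` vanishes. -/
lemma eq_zero_of_bilin (S : System m μ ε Δ) (hm : 1 ≤ m) {p : ℂ[X]} {N : ℕ}
    (hN : p.natDegree ≤ N) (h : ∀ i ≤ N, bilin m μ ε (X ^ i) p = 0) : p = 0 := by
  -- Zero counting needs real polynomials. Applying a real functional `L` to the coefficients
  -- commutes with the transforms, so `mapCoeff L p` is again orthogonal; real and imaginary parts
  -- then kill the leading coefficient.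
  have key : ∀ L : ℂ →L[ℝ] ℝ, L p.leadingCoeff = 0 := fun L => by
    rw [← coeff_mapCoeff, S.eq_zero_of_orthogonal_real hm (p := mapCoeff L p)
      ((natDegree_mapCoeff_le L p).trans hN), coeff_zero]
    intro i hi
    have hε : ε 1 ≠ 0 := by rcases S.sign 1 with h | h <;> simp [h]
    have h1 := (smul_eq_zero.1 (h i hi)).resolve_left hε
    have h2 := congrArg L h1
    rw [← L.integral_comp_comm (S.integrable_bilin hm _ p), map_zero] at h2
    rw [← h2]
    refine integral_congr_ae ?_
    filter_upwards [S.ae_mem_gapInterval le_rfl hm] with x hx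
    rw [eval_pow, eval_X, ← Complex.ofReal_pow, ← Complex.real_smul, map_smul,
      S.map_iterCauchy L (tame_complex p) (m - 1) 1 le_rfl (by omega) x hx, smul_eq_mul]
    simp_rw [eval_mapCoeff]
  rw [← leadingCoeff_eq_zero]
  exact Complex.ext (key Complex.reCLM) (key Complex.imCLM)

end System

end Pairing

/-! ### Signed measures of constant sign as multiples of their variation -/

section SignedMeasures

instance isFiniteMeasure_variation (s : SignedMeasure ℝ) : IsFiniteMeasure s.variation := by
  rw [← SignedMeasure.totalVariation_eq_variation]
  infer_instance

lemma vectorIntegral_eq {E : Type*} [NormedAddCommGroup E] [NormedSpace ℝ E]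
    {s : SignedMeasure ℝ} {e : ℝ} {ν : Measure ℝ} [IsFiniteMeasure ν]
    (hs : s = e • ν.toSignedMeasure) (f : ℝ → E) :
    ∫ᵛ x, f x ∂<•s = e • ∫ x, f x ∂ν := by
  rw [hs, VectorMeasure.integral_smul_vectorMeasure, VectorMeasure.integral_toSignedMeasure]

lemma lsmul_eq_flip : ContinuousLinearMap.lsmul ℝ ℝ (E := ℝ) =
    (ContinuousLinearMap.lsmul ℝ ℝ).flip := by
  ext
  simp

lemma eq_smul_variation_of_nonneg {s : SignedMeasure ℝ} (h : 0 ≤ s) :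
    s = (1 : ℝ) • s.variation.toSignedMeasure := by
  have h' := (VectorMeasure.le_restrict_univ_iff_le _ _).2 h
  have e := s.toMeasureOfZeroLE_toSignedMeasure h'
  have e' : s.variation = s.toMeasureOfZeroLE Set.univ MeasurableSet.univ h' := by
    conv_lhs => rw [← e]
    exact Measure.variation_toSignedMeasure
  rw [one_smul, Measure.toSignedMeasure_congr e', e]

lemma eq_smul_variation_of_nonpos {s : SignedMeasure ℝ} (h : s ≤ 0) :
    s = (-1 : ℝ) • s.variation.toSignedMeasure := by
  have h1 : 0 ≤ -s := fun i hi => by simpa using h i hi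
  have e := eq_smul_variation_of_nonneg h1
  rw [Measure.toSignedMeasure_congr (VectorMeasure.variation_neg (μ := s)), one_smul] at e
  rw [← e]
  ext i _
  simp

/-- The total variations of a family of signed measures. -/
abbrev absMeasure (σ : ℕ → SignedMeasure ℝ) : ℕ → Measure ℝ := fun j => (σ j).variation

/-- The numbers `ε j` are the signs of the measures `σ j`, for `1 ≤ j ≤ m`. -/
def HasSigns (m : ℕ) (σ : ℕ → SignedMeasure ℝ) (ε : ℕ → ℝ) : Prop :=
  ∀ j, 1 ≤ j → j ≤ m → σ j = ε j • (σ j).variation.toSignedMeasure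

end SignedMeasures

/-! ### Absence of cancellation -/

section ConstantSign

lemma enorm_integral_eq_of_constSign {ν : Measure ℝ} {G : ℝ → ℝ} (hG : Integrable G ν) {c : ℝ}
    (hc : c = 1 ∨ c = -1) (h : ∀ᵐ x ∂ν, 0 ≤ c * G x) : ‖∫ x, G x ∂ν‖ₑ = ∫⁻ x, ‖G x‖ₑ ∂ν := by
  have habs : ∀ y : ℝ, ‖y‖ = ‖c * y‖ := fun y => by rcases hc with rfl | rfl <;> simp
  rw [← ofReal_integral_norm_eq_lintegral_enorm hG, ← ofReal_norm, habs, ← integral_const_mul,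
    Real.norm_of_nonneg (integral_nonneg_of_ae h)]
  congr 1
  refine integral_congr_ae (h.mono fun x hx => ?_)
  simp only
  rw [habs (G x), Real.norm_of_nonneg hx]

namespace PreSystem

variable {m : ℕ} {μ : ℕ → Measure ℝ} {ε : ℕ → ℝ} {Δ : ℕ → Set ℝ}

lemma exists_sign_inv_sub (S : PreSystem m μ ε Δ) {j : ℕ} (hj : 1 ≤ j) (hm : j < m) :
    ∃ s : ℝ, (s = 1 ∨ s = -1) ∧ ∀ x ∈ Δ j, ∀ t ∈ Δ (j + 1), 0 ≤ s * (x - t)⁻¹ := by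
  rcases S.separated j hj hm with h | h
  · refine ⟨-1, by simp, fun x hx t ht => ?_⟩
    have := inv_nonpos.2 (sub_nonpos.2 (h x hx t ht))
    linarith
  · refine ⟨1, by simp, fun x hx t ht => ?_⟩
    have := inv_nonneg.2 (sub_nonneg.2 (h x hx t ht))
    linarith

/-- Separation fixes the sign of 1/(x - t) on `Δ j` × `Δ (j + 1)`, so constancy of sign passes from
each level to the next. -/
lemma exists_sign_iterCauchy_one (S : PreSystem m μ ε Δ) (l : ℕ) : ∀ j, 1 ≤ j → j + l ≤ m →
    ∃ c : ℝ, (c = 1 ∨ c = -1) ∧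
      ∀ x ∈ Δ j, 0 ≤ c * iterCauchy μ ε (fun _ => (1 : ℝ)) l (j + 1) x := by
  induction l with
  | zero => intro j _ _; exact ⟨1, by simp, by simp [iterCauchy]⟩
  | succ l ih =>
    intro j hj hl
    obtain ⟨c, hc, h⟩ := ih (j + 1) (by omega) (by omega)
    obtain ⟨s, hs, h'⟩ := S.exists_sign_inv_sub hj (by omega)
    have hε := S.sign (j + 1)
    refine ⟨s * ε (j + 1) * c, by rcases hs with rfl | rfl <;> rcases hε with h0 | h0 <;>
      rcases hc with rfl | rfl <;> simp [h0], fun x hx => ?_⟩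
    rw [iterCauchy, smul_eq_mul]
    have hε2 : ε (j + 1) * ε (j + 1) = 1 := by rcases hε with h | h <;> simp [h]
    have e : ∀ I : ℝ, s * ε (j + 1) * c * (ε (j + 1) * I) = (s * c) * I := fun I => by
      linear_combination (s * c * I) * hε2
    rw [e, ← integral_const_mul]
    refine integral_nonneg_of_ae ?_
    filter_upwards [S.ae_mem (j + 1) (by omega) (by omega)] with t ht
    refine (mul_nonneg (h' x hx t ht) (h t ht)).trans (le_of_eq ?_)
    rw [smul_eq_mul]
    ring

/-- With integrands of constant sign, the absolute value passes inside every integral. This upgrades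
integrability of the signed transforms to absolute convergence. -/
lemma enorm_iterCauchy_one (S : PreSystem m μ ε Δ)
    (hint : ∀ j l, 1 ≤ j → j + l ≤ m →
      Integrable (iterCauchy μ ε (fun _ => (1 : ℝ)) l (j + 1)) (μ j)) (l : ℕ) :
    ∀ j, 1 ≤ j → j + l ≤ m → ∀ x ∈ gapInterval m Δ j,
      ‖iterCauchy μ ε (fun _ => (1 : ℝ)) l (j + 1) x‖ₑ = absCauchy μ (fun _ => 1) l (j + 1) x := by
  induction l with
  | zero => intro j _ _ x _; simp [iterCauchy, absCauchy]
  | succ l ih =>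
    intro j hj hl x hx
    have hcl := S.isClosed (j + 1) (by omega) (by omega)
    have hmem := S.ae_mem (j + 1) (by omega) (by omega)
    obtain ⟨c, hc, h⟩ := S.exists_sign_iterCauchy_one l (j + 1) (by omega) (by omega)
    obtain ⟨s, hs, h'⟩ := S.exists_sign_inv_sub hj (by omega)
    have hε : ‖ε (j + 1)‖ₑ = 1 := by rcases S.sign (j + 1) with h | h <;> simp [h]
    rw [iterCauchy, absCauchy, enorm_smul, hε, one_mul,
      enorm_integral_eq_of_constSign (integrable_inv_sub_smul hcl hmem (hx.2 (by omega))
        (hint (j + 1) l (by omega) (by omega))) (c := s * c)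
        (by rcases hs with rfl | rfl <;> rcases hc with rfl | rfl <;> simp)]
    · refine lintegral_congr_ae ?_
      filter_upwards [S.ae_mem_gapInterval (j := j + 1) (by omega) (by omega)] with t ht
      rw [enorm_smul, ih (j + 1) (by omega) (by omega) t ht]
    · filter_upwards [hmem] with t ht
      refine (mul_nonneg (h' x hx.1 t ht) (h t ht)).trans (le_of_eq ?_)
      rw [smul_eq_mul]
      ring

lemma toSystem (S : PreSystem m μ ε Δ)
    (hint : ∀ j l, 1 ≤ j → j + l ≤ m →
      Integrable (iterCauchy μ ε (fun _ => (1 : ℝ)) l (j + 1)) (μ j)) : System m μ ε Δ where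
  toPreSystem := S
  absCauchy_one j l hj hl := by
    refine ne_of_eq_of_ne (lintegral_congr_ae ?_) (hint j l hj hl).2.ne
    filter_upwards [S.ae_mem_gapInterval hj (by omega)] with x hx
    exact (S.enorm_iterCauchy_one hint l j hj hl x hx).symm

end PreSystem

end ConstantSign

/-! ### The measures s_{j,k} through iterated transforms -/

section Chain

variable {m : ℕ} {σ : ℕ → SignedMeasure ℝ} {ε : ℕ → ℝ} {Δ : ℕ → Set ℝ}

/-- The measure `⟨σ_j, …, σ_{j+l}⟩` has the iterated Cauchy transform as its density with
respect to `σ_j`. -/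
def ChainFormula (σ : ℕ → SignedMeasure ℝ) (ε : ℕ → ℝ) (l j : ℕ) : Prop :=
  ∀ (E : Type) [NormedAddCommGroup E] [NormedSpace ℝ E] (f : ℝ → E),
    ∫ᵛ x, f x ∂<•(chain σ l j) =
      ε j • ∫ t, iterCauchy (absMeasure σ) ε (fun _ => (1 : ℝ)) l (j + 1) t • f t ∂(σ j).variation

lemma ChainFormula.cauchyReal {l j : ℕ} (h : ChainFormula σ ε l j) :
    cauchyReal (chain σ l j) = iterCauchy (absMeasure σ) ε (fun _ => (1 : ℝ)) (l + 1) j := by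
  ext x
  rw [Nikishin.cauchyReal, lsmul_eq_flip, h ℝ, iterCauchy]
  simp only [smul_eq_mul, mul_comm]

lemma ChainFormula.cauchy {l j : ℕ} (h : ChainFormula σ ε l j) (z : ℂ) :
    cauchy (chain σ l j) z = ε j • ∫ t : ℝ, (z - t)⁻¹ *
      ((iterCauchy (absMeasure σ) ε (fun _ => (1 : ℝ)) l (j + 1) t : ℝ) : ℂ) ∂(σ j).variation := by
  rw [Nikishin.cauchy, h ℂ]
  simp only [Complex.real_smul, mul_comm]

lemma chainFormula_zero (hσ : HasSigns m σ ε) {j : ℕ} (hj : 1 ≤ j) (hm : j ≤ m) :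
    ChainFormula σ ε 0 j := by
  intro E _ _ f
  simpa [iterCauchy, chain] using vectorIntegral_eq (hσ j hj hm) f

/-- The density `H` has a constant sign `c`, so the bracket is again a sign times a positive
measure, with density |H|; integrals against it become ordinary weighted integrals. -/
lemma chainFormula_succ (S : PreSystem m (absMeasure σ) ε Δ) (hσ : HasSigns m σ ε) {j l : ℕ}
    (hj : 1 ≤ j) (hm : j + (l + 1) ≤ m) (h : ChainFormula σ ε l (j + 1))
    (hint : Integrable (iterCauchy (absMeasure σ) ε (fun _ => (1 : ℝ)) (l + 1) (j + 1))
      (σ j).variation) : ChainFormula σ ε (l + 1) j := by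
  intro E _ _ f
  obtain ⟨c, hc, hsign⟩ := S.exists_sign_iterCauchy_one (l + 1) j hj hm
  set H := iterCauchy (absMeasure σ) ε (fun _ => (1 : ℝ)) (l + 1) (j + 1) with hH
  have hHm : StronglyMeasurable H := stronglyMeasurable_iterCauchy stronglyMeasurable_const _ _
  set ν := (σ j).variation.withDensity (fun x => ‖H x‖ₑ) with hν
  have : IsFiniteMeasure ν := isFiniteMeasure_withDensity hint.2.ne
  have hnorm : ∀ᵐ x ∂(σ j).variation, c * ‖H x‖ = H x := by
    filter_upwards [S.ae_mem j hj (by omega)] with x hx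
    have := hsign x hx
    rcases hc with rfl | rfl
    · rw [one_mul] at this ⊢
      exact Real.norm_of_nonneg this
    · rw [Real.norm_of_nonpos (by linarith)]
      ring
  have hchain : chain σ (l + 1) j = (ε j * c) • ν.toSignedMeasure := by
    ext A hA
    rw [chain, bracket, h.cauchyReal, VectorMeasure.withDensity_apply hint]
    have hr : (σ j).restrict A = ε j • ((σ j).variation.restrict A).toSignedMeasure := by
      conv_lhs => rw [hσ j hj (by omega)]
      rw [VectorMeasure.restrict_smul, VectorMeasure.restrict_toSignedMeasure hA]
    rw [lsmul_eq_flip, vectorIntegral_eq hr, _root_.smul_apply,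
      Measure.toSignedMeasure_apply_measurable hA, hν, measureReal_def, withDensity_apply _ hA,
      ← integral_norm_eq_lintegral_enorm hHm.aestronglyMeasurable, smul_eq_mul, smul_eq_mul,
      mul_assoc, ← integral_const_mul c]
    congr 1
    exact integral_congr_ae (ae_restrict_of_ae (hnorm.mono fun x hx => hx.symm))
  rw [vectorIntegral_eq hchain, hν, integral_withDensity_eq_integral_toReal_smul hHm.enorm
    (Eventually.of_forall fun _ => enorm_lt_top), mul_smul, ← integral_smul]
  congr 1
  refine integral_congr_ae ?_
  filter_upwards [hnorm] with x hx
  rw [toReal_enorm, smul_smul, hx]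

lemma System.chainFormula (S : System m (absMeasure σ) ε Δ) (hσ : HasSigns m σ ε) (l : ℕ) :
    ∀ j, 1 ≤ j → j + l ≤ m → ChainFormula σ ε l j := by
  induction l with
  | zero => intro j hj hm; exact chainFormula_zero hσ hj hm
  | succ l ih =>
    intro j hj hm
    exact chainFormula_succ S.toPreSystem hσ hj hm (ih (j + 1) (by omega) (by omega))
      (S.integrable_iterCauchy tame_one hj hm)

end Chain

/-! ### Convex hulls and separation on the line -/

section Intervals

/-- A limit point of the hull outside `A` has points of `A` on both sides: otherwise `A`, which
stays at distance `r` from it, lies in a closed half-line missing it. No compactness is needed. -/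
lemma isClosed_convexHull_real {A : Set ℝ} (hA : IsClosed A) : IsClosed (convexHull ℝ A) := by
  refine isClosed_of_closure_subset fun x hx => ?_
  have side : ∀ B : Set ℝ, Convex ℝ B → IsClosed B → A ⊆ B → x ∈ B := fun B h1 h2 h3 =>
    closure_minimal (convexHull_min h3 h1) h2 hx
  by_cases hxA : x ∈ A
  · exact subset_convexHull ℝ A hxA
  obtain ⟨r, hr, h⟩ := Metric.isOpen_iff.1 hA.isOpen_compl x hxA
  have hfar : ∀ a ∈ A, r ≤ |a - x| := fun a ha => by
    by_contra! h1
    exact h (a := a) (by rwa [Metric.mem_ball, Real.dist_eq]) ha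
  have h1 : ∃ a ∈ A, a ≤ x := by
    by_contra! h1
    have := side (Set.Ici (x + r)) (convex_Ici _) isClosed_Ici fun a ha => by
      have := hfar a ha
      rw [abs_of_pos (sub_pos.2 (h1 a ha))] at this
      exact le_sub_iff_add_le'.1 this
    linarith [Set.mem_Ici.1 this]
  have h2 : ∃ a ∈ A, x ≤ a := by
    by_contra! h1
    have := side (Set.Iic (x - r)) (convex_Iic _) isClosed_Iic fun a ha => by
      have := hfar a ha
      rw [abs_of_neg (sub_neg.2 (h1 a ha))] at this
      exact Set.mem_Iic.2 (by linarith)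
    linarith [Set.mem_Iic.1 this]
  obtain ⟨a, ha, hax⟩ := h1
  obtain ⟨b, hb, hxb⟩ := h2
  exact (convex_convexHull ℝ A).ordConnected.out (subset_convexHull ℝ A ha)
    (subset_convexHull ℝ A hb) ⟨hax, hxb⟩

/-- Without separation, nondegenerate segments of `A` and `B` overlap in more than a point.
Nontriviality excludes a singleton interior to the other interval. -/
lemma separated_of_inter_subsingleton {A B : Set ℝ} (hA : A.OrdConnected) (hB : B.OrdConnected)
    (hA' : A.Nontrivial) (hB' : B.Nontrivial) (h : (A ∩ B).Subsingleton) :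
    (∀ x ∈ A, ∀ t ∈ B, x ≤ t) ∨ (∀ x ∈ A, ∀ t ∈ B, t ≤ x) := by
  by_contra! hc
  obtain ⟨⟨x, hx, t, ht, htx⟩, x', hx', t', ht', hxt⟩ := hc
  have extend : ∀ {C : Set ℝ}, C.OrdConnected → C.Nontrivial → ∀ y ∈ C, ∀ y' ∈ C,
      ∃ u ∈ C, ∃ v ∈ C, u < v ∧ u ≤ y ∧ u ≤ y' ∧ y ≤ v ∧ y' ≤ v := by
    intro C _ hC y hy y' hy'
    rcases lt_trichotomy y y' with h | rfl | h
    · exact ⟨y, hy, y', hy', h, le_rfl, h.le, h.le, le_rfl⟩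
    · obtain ⟨z, hz, hne⟩ := hC.exists_ne y
      rcases hne.lt_or_gt with h | h
      · exact ⟨z, hz, y, hy, h, h.le, h.le, le_rfl, le_rfl⟩
      · exact ⟨y, hy, z, hz, h, le_rfl, le_rfl, h.le, h.le⟩
    · exact ⟨y', hy', y, hy, h, h.le, le_rfl, le_rfl, h.le⟩
  obtain ⟨a, ha, a', ha', haa, h1, h2, h3, h4⟩ := extend hA hA' x hx x' hx'
  obtain ⟨b, hb, b', hb', hbb, k1, k2, k3, k4⟩ := extend hB hB' t ht t' ht'
  have hlt : max a b < min a' b' := by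
    rw [max_lt_iff, lt_min_iff, lt_min_iff]
    refine ⟨⟨haa, by linarith⟩, by linarith, hbb⟩
  have hl : max a b ∈ A ∩ B :=
    ⟨hA.out ha ha' ⟨le_max_left _ _, hlt.le.trans (min_le_left _ _)⟩,
      hB.out hb hb' ⟨le_max_right _ _, hlt.le.trans (min_le_right _ _)⟩⟩
  have hr : min a' b' ∈ A ∩ B :=
    ⟨hA.out ha ha' ⟨(le_max_left _ _).trans hlt.le, min_le_left _ _⟩,
      hB.out hb hb' ⟨(le_max_right _ _).trans hlt.le, min_le_right _ _⟩⟩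
  exact hlt.ne (h hl hr)

end Intervals

/-! ### From a Nikishin generator to a `System` -/

section Generators

variable {m : ℕ} {σ : ℕ → SignedMeasure ℝ}

open scoped Classical in
/-- The sign of a measure of constant sign. -/
def signOf (s : SignedMeasure ℝ) : ℝ := if 0 ≤ s then 1 else -1

lemma signOf_eq (s : SignedMeasure ℝ) : signOf s = 1 ∨ signOf s = -1 := by
  unfold signOf
  split_ifs <;> simp

lemma ClassM.eq_signOf_smul {s : SignedMeasure ℝ} {D : Set ℝ} (h : ClassM s D) :
    s = signOf s • s.variation.toSignedMeasure := by
  unfold signOf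
  split_ifs with h0
  · exact eq_smul_variation_of_nonneg h0
  · exact eq_smul_variation_of_nonpos (h.constSign.resolve_left h0)

lemma lintegral_weight_ne_top {ν : Measure ℝ} (h : ∀ k : ℕ, Integrable (fun x : ℝ => x ^ k) ν)
    (n : ℕ) : ∫⁻ x, weight n x ∂ν ≠ ∞ := by
  have hi : Integrable (fun x : ℝ => (1 + ‖x‖) ^ n) ν := by
    simp_rw [add_pow, one_pow, one_mul]
    refine integrable_finsetSum _ fun k _ =>
      ((h (n - k)).norm.mul_const (n.choose k : ℝ)).congr ?_
    exact Eventually.of_forall fun x => by simp [norm_pow]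
  refine ne_of_eq_of_ne (lintegral_congr fun x => ?_) hi.2.ne
  rw [enorm_pow, weight, Real.enorm_of_nonneg (add_nonneg zero_le_one (norm_nonneg x)), ENNReal.ofReal_add zero_le_one
    (norm_nonneg x), ENNReal.ofReal_one, ofReal_norm]

lemma variation_singleton {s : SignedMeasure ℝ} {e : ℝ} (he : e = 1 ∨ e = -1)
    (hs : s = e • s.variation.toSignedMeasure) {x : ℝ} (hx : s {x} = 0) : s.variation {x} = 0 := by
  rw [hs, _root_.smul_apply, Measure.toSignedMeasure_apply_measurable (measurableSet_singleton x),
    smul_eq_mul, mul_eq_zero] at hx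
  have : e ≠ 0 := by rcases he with h | h <;> simp [h]
  exact (measureReal_eq_zero_iff).1 (hx.resolve_left this)

lemma ae_notMem_of_inter {ν : Measure ℝ} {A B : Set ℝ} (hA : ∀ᵐ x ∂ν, x ∈ A)
    (h : (A ∩ B).Subsingleton) (h0 : ∀ x ∈ A ∩ B, ν {x} = 0) : ∀ᵐ x ∂ν, x ∉ B := by
  have hAB : ν (A ∩ B) = 0 := by
    rcases h.eq_empty_or_singleton with e | ⟨x, e⟩
    · rw [e, measure_empty]
    · rw [e]
      exact h0 x (e ▸ rfl)
  filter_upwards [hA, measure_eq_zero_iff_ae_notMem.1 hAB] with x hx hx' hB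
  exact hx' ⟨hx, hB⟩

namespace IsGenerator

lemma hasSigns (hσ : IsGenerator m σ) : HasSigns m σ (fun j => signOf (σ j)) :=
  fun j h1 h2 => (hσ.mem_classM j h1 h2).eq_signOf_smul

lemma ae_mem_hull (s : SignedMeasure ℝ) : ∀ᵐ x ∂s.variation, x ∈ hull s :=
  Filter.mem_of_superset Measure.support_mem_ae (subset_convexHull ℝ _)

lemma preSystem (hσ : IsGenerator m σ) :
    PreSystem m (absMeasure σ) (fun j => signOf (σ j)) (fun j => hull (σ j)) where
  sign j := signOf_eq _
  isClosed j _ _ := isClosed_convexHull_real Measure.isClosed_support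
  ordConnected j _ _ := (convex_convexHull ℝ _).ordConnected
  ae_mem j _ _ := ae_mem_hull _
  not_finite j h1 h2 s hs := (hσ.mem_classM j h1 h2).infinite_supp
    (s.finite_toSet.subset (Measure.support_subset_of_isClosed s.finite_toSet.isClosed hs))
  separated j h1 h2 := separated_of_inter_subsingleton (convex_convexHull ℝ _).ordConnected
    (convex_convexHull ℝ _).ordConnected
    ((hσ.mem_classM j h1 h2.le).infinite_supp.nontrivial.mono (subset_convexHull ℝ _))
    ((hσ.mem_classM (j + 1) (by omega) h2).infinite_supp.nontrivial.mono (subset_convexHull ℝ _))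
    (hσ.inter_subsingleton j h1 h2)
  ae_notMem_succ j h1 h2 := ae_notMem_of_inter (ae_mem_hull _) (hσ.inter_subsingleton j h1 h2)
    fun x hx => variation_singleton (signOf_eq _) (hσ.hasSigns j h1 h2.le)
      (hσ.not_mass j h1 h2 x hx).1
  ae_notMem_pred j h1 h2 := by
    refine ae_notMem_of_inter (ae_mem_hull _) (A := hull (σ (j + 1))) ?_ fun x hx =>
      variation_singleton (signOf_eq _) (hσ.hasSigns (j + 1) (by omega) h2)
        (hσ.not_mass j h1 h2 x hx.symm).2
    rw [Set.inter_comm]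
    exact hσ.inter_subsingleton j h1 h2
  moments j h1 h2 := lintegral_weight_ne_top (hσ.mem_classM j h1 h2).moments

lemma chainFormula (hσ : IsGenerator m σ) (l : ℕ) : ∀ j, 1 ≤ j → j + l ≤ m →
    ChainFormula σ (fun j => signOf (σ j)) l j := by
  induction l with
  | zero => intro j h1 h2; exact chainFormula_zero hσ.hasSigns h1 h2
  | succ l ih =>
    intro j h1 h2
    have h := ih (j + 1) (by omega) (by omega)
    refine chainFormula_succ hσ.preSystem hσ.hasSigns h1 h2 h ?_
    rw [← h.cauchyReal]
    have := hσ.integrable j (j + (l + 1)) h1 (by omega) h2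
    rwa [sMeas, show j + (l + 1) - (j + 1) = l by omega] at this

lemma system (hσ : IsGenerator m σ) :
    System m (absMeasure σ) (fun j => signOf (σ j)) (fun j => hull (σ j)) := by
  refine hσ.preSystem.toSystem fun j l h1 h2 => ?_
  cases l with
  | zero => exact integrable_const 1
  | succ l =>
    rw [← (hσ.chainFormula l (j + 1) (by omega) (by omega)).cauchyReal]
    have := hσ.integrable j (j + (l + 1)) h1 (by omega) h2
    rwa [sMeas, show j + (l + 1) - (j + 1) = l by omega] at this

end IsGenerator

end Generators

/-! ### Decay along the imaginary axis -/

section Decay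

/-- The complex number `z` has positive distance from almost all `t`. -/
def Away (ν : Measure ℝ) (z : ℂ) : Prop := ∃ δ > 0, ∀ᵐ t : ℝ ∂ν, δ ≤ ‖z - t‖

lemma le_norm_mul_I_sub (y t : ℝ) : |y| ≤ ‖(y : ℂ) * Complex.I - t‖ := by
  refine le_trans (le_of_eq ?_) (Complex.abs_im_le_norm _)
  simp

lemma away_mul_I (ν : Measure ℝ) {y : ℝ} (hy : 0 < y) : Away ν (y * Complex.I) :=
  ⟨y, hy, Eventually.of_forall fun t => (le_abs_self y).trans (le_norm_mul_I_sub y t)⟩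

lemma away_ofReal {ν : Measure ℝ} {A : Set ℝ} (hA : IsClosed A) (hmem : ∀ᵐ x ∂ν, x ∈ A) {x : ℝ}
    (hx : x ∉ A) : Away ν x := by
  obtain ⟨δ, hδ, h⟩ := exists_pos_le_abs_sub hA hx
  refine ⟨δ, hδ, hmem.mono fun t ht => ?_⟩
  rw [← Complex.ofReal_sub, Complex.norm_real]
  exact h x (by simpa) t ht

lemma Away.integrable {ν : Measure ℝ} {z : ℂ} (hz : Away ν z) {F : ℝ → ℂ} (hF : Integrable F ν) :
    Integrable (fun t : ℝ => (z - t)⁻¹ * F t) ν := by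
  obtain ⟨δ, hδ, h⟩ := hz
  refine (hF.norm.const_mul δ⁻¹).mono' ((by fun_prop : Measurable fun t : ℝ =>
    (z - t)⁻¹).aestronglyMeasurable.mul hF.aestronglyMeasurable) ?_
  filter_upwards [h] with t ht
  rw [norm_mul, norm_inv]
  gcongr

lemma Away.inv_mul_cancel {ν : Measure ℝ} {z : ℂ} (hz : Away ν z) :
    ∀ᵐ t : ℝ ∂ν, (z - t)⁻¹ * (z - t) = 1 := by
  obtain ⟨δ, hδ, h⟩ := hz
  exact h.mono fun t ht => inv_mul_cancel₀ (norm_pos_iff.1 (hδ.trans_le ht))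

lemma Away.integral_mul_id {ν : Measure ℝ} {z : ℂ} (hz : Away ν z) {F : ℝ → ℂ}
    (hF : Integrable F ν) :
    ∫ t : ℝ, (z - t)⁻¹ * (t * F t) ∂ν = z * ∫ t : ℝ, (z - t)⁻¹ * F t ∂ν - ∫ t, F t ∂ν := by
  rw [← integral_const_mul, ← integral_sub ((hz.integrable hF).const_mul z) hF]
  refine integral_congr_ae ?_
  filter_upwards [hz.inv_mul_cancel] with t ht
  linear_combination (-F t) * ht

lemma tendsto_integral_mul_I {ν : Measure ℝ} {F : ℝ → ℂ} (hF : Integrable F ν) :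
    Tendsto (fun y : ℝ => ∫ t : ℝ, ((y : ℂ) * Complex.I - t)⁻¹ * F t ∂ν) atTop (𝓝 0) := by
  have h0 : Tendsto (fun y : ℝ => y⁻¹ * ∫ t, ‖F t‖ ∂ν) atTop (𝓝 0) := by
    simpa using tendsto_inv_atTop_zero.mul_const (∫ t, ‖F t‖ ∂ν)
  refine squeeze_zero_norm' ?_ h0
  filter_upwards [eventually_gt_atTop 0] with y hy
  rw [← integral_const_mul]
  refine norm_integral_le_of_norm_le (hF.norm.const_mul _) (Eventually.of_forall fun t => ?_)
  rw [norm_mul, norm_inv]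
  gcongr
  exact (le_abs_self y).trans (le_norm_mul_I_sub y t)

lemma eq_zero_of_tendsto_mul_I {P : ℂ[X]}
    (h : Tendsto (fun y : ℝ => P.eval ((y : ℂ) * Complex.I)) atTop (𝓝 0)) : P = 0 := by
  by_cases hd : 0 < P.degree
  · have h1 : Tendsto (fun y : ℝ => ‖(y : ℂ) * Complex.I‖) atTop atTop := by
      simpa using tendsto_abs_atTop_atTop
    exact (not_tendsto_nhds_of_tendsto_atTop (P.tendsto_norm_atTop hd h1) _ h.norm).elim
  · rw [eq_C_of_degree_le_zero (not_lt.1 hd)] at h ⊢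
    simp only [eval_C] at h
    rw [tendsto_nhds_unique tendsto_const_nhds h, C_0]

/-- The point iy has distance at least |y| from any real set, so the imaginary axis lies in the
non-tangential region with c = 1. No other direction is used. -/
lemma tendsto_mul_I {D : Set ℝ} (hD : D.Nonempty) :
    Tendsto (fun y : ℝ => (y : ℂ) * Complex.I) atTop (Bornology.cobounded ℂ ⊓
      𝓟 {z : ℂ | 1 * ‖z‖ ≤ Metric.infDist z (Complex.ofReal '' D)}) := by
  refine tendsto_inf.2 ⟨?_, tendsto_principal.2 (Eventually.of_forall fun y => ?_)⟩
  · rw [← tendsto_norm_atTop_iff_cobounded]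
    simpa using tendsto_abs_atTop_atTop
  · rw [Set.mem_ofPred_eq, one_mul, Metric.le_infDist (hD.image _)]
    rintro _ ⟨t, -, rfl⟩
    rw [Complex.dist_eq]
    refine le_trans (le_of_eq ?_) (le_norm_mul_I_sub y t)
    simp

lemma IsBigOInfty.mul_I {D : Set ℝ} (hD : D.Nonempty) {f : ℂ → ℂ} {N : ℕ}
    (h : IsBigOInfty D f N) : (fun y : ℝ => f (y * Complex.I)) =O[atTop]
      fun y : ℝ => (((y : ℂ) * Complex.I) ^ N)⁻¹ :=
  (h 1 one_pos).comp_tendsto (tendsto_mul_I hD)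

lemma tendsto_inv_mul_I : Tendsto (fun y : ℝ => ((y : ℂ) * Complex.I)⁻¹) atTop (𝓝 0) := by
  rw [tendsto_zero_iff_norm_tendsto_zero]
  simpa [Function.comp_def] using
    (tendsto_inv_atTop_zero (𝕜 := ℝ)).comp tendsto_abs_atTop_atTop

/-- A power times a function that decays faster tends to zero. -/
lemma IsBigOInfty.tendsto_pow_mul {D : Set ℝ} (hD : D.Nonempty) {f : ℂ → ℂ} {N k : ℕ}
    (h : IsBigOInfty D f N) (hk : k < N) :
    Tendsto (fun y : ℝ => ((y : ℂ) * Complex.I) ^ k * f (y * Complex.I)) atTop (𝓝 0) := by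
  have h1 := (Asymptotics.isBigO_refl (fun y : ℝ => ((y : ℂ) * Complex.I) ^ k) atTop).mul
    (h.mul_I hD)
  refine h1.trans_tendsto ?_
  have h2 := tendsto_inv_mul_I.pow (N - k)
  rw [zero_pow (by omega)] at h2
  refine h2.congr' ?_
  filter_upwards [eventually_gt_atTop 0] with y hy
  have hz : (y : ℂ) * Complex.I ≠ 0 := by simp [hy.ne']
  obtain ⟨r, rfl⟩ := Nat.exists_eq_add_of_lt hk
  generalize (y : ℂ) * Complex.I = z at hz ⊢
  rw [show k + r + 1 - k = r + 1 by omega, add_assoc, pow_add _ k, mul_inv, ← mul_assoc,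
    mul_inv_cancel₀ (pow_ne_zero k hz), one_mul, inv_pow]

/-- The moments of a function whose Cauchy transform is `O(1/z^{n+1})` vanish up to order `n-1`. -/
lemma moments_eq_zero {ν : Measure ℝ} {D : Set ℝ} (hD : D.Nonempty) {F : ℝ → ℂ} {f : ℂ → ℂ}
    {n : ℕ} (hF : ∀ k : ℕ, Integrable (fun t : ℝ => (t : ℂ) ^ k * F t) ν)
    (hf : ∀ y : ℝ, 0 < y → f (y * Complex.I) =
      ∫ t : ℝ, ((y : ℂ) * Complex.I - t)⁻¹ * F t ∂ν)
    (h : IsBigOInfty D f (n + 1)) {k : ℕ} (hk : k < n) : ∫ t : ℝ, (t : ℂ) ^ k * F t ∂ν = 0 := by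
  have shift : ∀ (k : ℕ) {y : ℝ}, 0 < y →
      ∫ t : ℝ, ((y : ℂ) * Complex.I - t)⁻¹ * ((t : ℂ) ^ (k + 1) * F t) ∂ν =
      (y * Complex.I) * ∫ t : ℝ, ((y : ℂ) * Complex.I - t)⁻¹ * ((t : ℂ) ^ k * F t) ∂ν -
        ∫ t : ℝ, (t : ℂ) ^ k * F t ∂ν := fun k y hy => by
    rw [← (away_mul_I ν hy).integral_mul_id (hF k)]
    simp only [pow_succ', mul_assoc]
  -- In the identity `shift`, z^(k+1) f(z) tends to 0 because k + 1 ≤ n, and so does the transform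
  -- of t^(k+1) F; what remains is the k-th moment.
  have vanish : ∀ k < n, (∀ y : ℝ, 0 < y →
      ∫ t : ℝ, ((y : ℂ) * Complex.I - t)⁻¹ * ((t : ℂ) ^ k * F t) ∂ν =
        (y * Complex.I) ^ k * f (y * Complex.I)) → ∫ t : ℝ, (t : ℂ) ^ k * F t ∂ν = 0 := by
    intro k hk hy
    have h1 := h.tendsto_pow_mul hD (k := k + 1) (by omega)
    have h2 := h1.sub (tendsto_integral_mul_I (hF (k + 1)))
    rw [sub_zero] at h2
    refine tendsto_nhds_unique (tendsto_const_nhds.congr' ?_) h2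
    filter_upwards [eventually_gt_atTop 0] with y hy0
    rw [shift k hy0, hy y hy0]
    ring
  have main : ∀ k ≤ n, ∀ y : ℝ, 0 < y →
      ∫ t : ℝ, ((y : ℂ) * Complex.I - t)⁻¹ * ((t : ℂ) ^ k * F t) ∂ν =
        (y * Complex.I) ^ k * f (y * Complex.I) := by
    intro k
    induction k with
    | zero => intro _ y hy; simpa using (hf y hy).symm
    | succ k ih =>
      intro hk y hy
      rw [shift k hy, vanish k (by omega) (ih (by omega)), ih (by omega) y hy]
      ring
  exact vanish k hk (main k hk.le)

/-- Multiplying a Cauchy transform by a polynomial changes it, up to a polynomial, into the Cauchy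
transform of the product. -/
lemma exists_polynomial_mul_integral {ν : Measure ℝ} {h : ℝ → ℂ}
    (hint : ∀ p : ℂ[X], Integrable (fun t : ℝ => p.eval (t : ℂ) * h t) ν) (a : ℂ[X]) :
    ∃ P : ℂ[X], ∀ z, Away ν z → a.eval z * ∫ t : ℝ, (z - t)⁻¹ * h t ∂ν =
      P.eval z + ∫ t : ℝ, (z - t)⁻¹ * (a.eval (t : ℂ) * h t) ∂ν := by
  induction a using Polynomial.induction_on with
  | C c =>
    refine ⟨0, fun z _ => ?_⟩
    simp only [eval_C, eval_zero, zero_add]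
    rw [← integral_const_mul]
    congr 1
    ext t
    ring
  | add p q hp hq =>
    obtain ⟨P, hP⟩ := hp
    obtain ⟨Q, hQ⟩ := hq
    refine ⟨P + Q, fun z hz => ?_⟩
    simp only [eval_add, add_mul, mul_add]
    rw [hP z hz, hQ z hz, integral_add (hz.integrable (hint p)) (hz.integrable (hint q))]
    ring
  | monomial n c hp =>
    obtain ⟨P, hP⟩ := hp
    refine ⟨X * P + C (∫ t : ℝ, (C c * X ^ n).eval (t : ℂ) * h t ∂ν), fun z hz => ?_⟩
    -- The identity t/(z - t) = z/(z - t) - 1 adds one constant to the polynomial part for each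
    -- factor of t.
    have e : C c * X ^ (n + 1) = X * (C c * X ^ n) := by ring
    rw [e]
    generalize C c * X ^ n = f at *
    have h1 := hz.integral_mul_id (hint f)
    simp only [eval_mul, eval_X, eval_add, eval_C, mul_assoc] at h1 ⊢
    rw [h1, hP z hz]
    ring

end Decay

/-! ### The linear forms of a multi-level Hermite–Padé vector -/

section Forms

variable {m : ℕ} {σ : ℕ → SignedMeasure ℝ} {ε : ℕ → ℝ} {Δ : ℕ → Set ℝ}

/-- The linear form `𝓐_j` on the real line. For `j = m` it is `(-1)^m a_m`. -/
def realForm (m : ℕ) (σ : ℕ → SignedMeasure ℝ) (ε : ℕ → ℝ) (a : ℕ → ℂ[X]) (j : ℕ) (x : ℝ) : ℂ :=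
  ∑ k ∈ Finset.Icc j m, (-1) ^ k * ((a k).eval (x : ℂ) *
    ((iterCauchy (absMeasure σ) ε (fun _ => (1 : ℝ)) (k - j) (j + 1) x : ℝ) : ℂ))

lemma System.form_ofReal (S : System m (absMeasure σ) ε Δ) (hσ : HasSigns m σ ε) (a : ℕ → ℂ[X])
    {j : ℕ} (hj : j < m) (x : ℝ) : form m σ a j x = realForm m σ ε a j x := by
  rw [form, realForm, ← Finset.insert_Icc_add_one_left_eq_Icc hj.le, Finset.sum_insert (by simp)]
  congr 1
  · simp [iterCauchy]
  · refine Finset.sum_congr rfl fun k hk => ?_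
    rw [Finset.mem_Icc] at hk
    rw [sMeas, (S.chainFormula hσ (k - (j + 1)) (j + 1) (by omega) (by omega)).cauchy,
      show k - j = k - (j + 1) + 1 by omega, iterCauchy, mul_assoc, smul_eq_mul, Complex.ofReal_mul,
      ← integral_complex_ofReal, Complex.real_smul]
    simp

lemma System.integrable_mul_iterCauchy_one (S : System m (absMeasure σ) ε Δ) {j l : ℕ} (hj : 1 ≤ j)
    (hl : j + l ≤ m) (p : ℂ[X]) : Integrable (fun x : ℝ => p.eval (x : ℂ) *
      ((iterCauchy (absMeasure σ) ε (fun _ => (1 : ℝ)) l (j + 1) x : ℝ) : ℂ)) (σ j).variation := by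
  obtain ⟨C, k, hC, h⟩ := (tame_complex p).bound
  refine ⟨((tame_complex p).stronglyMeasurable.mul
    (Complex.continuous_ofReal.comp_stronglyMeasurable (stronglyMeasurable_iterCauchy
      tame_one.stronglyMeasurable _ _))).aestronglyMeasurable, ?_⟩
  refine lt_of_le_of_lt (lintegral_mono fun x => ?_)
    (S.lintegral_mul_absCauchy hC ENNReal.one_ne_top h (g := fun _ => 1) (D := 1) (n := 0)
      (by simp) hj hl).lt_top
  rw [enorm_mul]
  refine mul_le_mul_right ?_ _
  have := enorm_iterCauchy_le (μ := absMeasure σ) S.sign (fun _ => (1 : ℝ)) l (j + 1) x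
  simpa [← ofReal_norm] using this

lemma System.integrable_mul_realForm (S : System m (absMeasure σ) ε Δ) (a : ℕ → ℂ[X]) {j : ℕ}
    (hj : 1 ≤ j) (p : ℂ[X]) :
    Integrable (fun x : ℝ => p.eval (x : ℂ) * realForm m σ ε a j x) (σ j).variation := by
  simp only [realForm, Finset.mul_sum]
  refine integrable_finsetSum _ fun k hk => ?_
  rw [Finset.mem_Icc] at hk
  refine ((S.integrable_mul_iterCauchy_one hj (l := k - j) (by omega) (p * a k)).const_mul
    ((-1) ^ k)).congr (Eventually.of_forall fun x => ?_)
  simp only [eval_mul]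
  ring

lemma System.exists_form_eq_add (S : System m (absMeasure σ) ε Δ) (hσ : HasSigns m σ ε)
    (a : ℕ → ℂ[X]) (j : ℕ) : ∃ P : ℂ[X], ∀ z, Away (σ (j + 1)).variation z →
      form m σ a j z = P.eval z +
        ε (j + 1) • ∫ t : ℝ, (z - t)⁻¹ * realForm m σ ε a (j + 1) t ∂(σ (j + 1)).variation := by
  have hint : ∀ k ∈ Finset.Icc (j + 1) m, ∀ p : ℂ[X], Integrable (fun x : ℝ => p.eval (x : ℂ) *
      ((iterCauchy (absMeasure σ) ε (fun _ => (1 : ℝ)) (k - (j + 1)) (j + 1 + 1) x : ℝ) : ℂ))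
      (σ (j + 1)).variation := fun k hk p => by
    rw [Finset.mem_Icc] at hk
    exact S.integrable_mul_iterCauchy_one (by omega) (by omega) p
  choose! P hP using fun k hk => exists_polynomial_mul_integral (hint k hk) (a k)
  refine ⟨C ((-1) ^ j) * a j +
    ∑ k ∈ Finset.Icc (j + 1) m, C ((-1) ^ k * (ε (j + 1) : ℂ)) * P k, fun z hz => ?_⟩
  have e : ∫ t : ℝ, (z - t)⁻¹ * realForm m σ ε a (j + 1) t ∂(σ (j + 1)).variation =
      ∑ k ∈ Finset.Icc (j + 1) m, (-1) ^ k * ∫ t : ℝ, (z - t)⁻¹ * ((a k).eval (t : ℂ) *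
        ((iterCauchy (absMeasure σ) ε (fun _ => (1 : ℝ)) (k - (j + 1)) (j + 1 + 1) t : ℝ) : ℂ))
        ∂(σ (j + 1)).variation := by
    simp_rw [← integral_const_mul]
    rw [← integral_finsetSum _ fun k hk => (hz.integrable (hint k hk (a k))).const_mul _]
    refine integral_congr_ae (Eventually.of_forall fun t => ?_)
    simp only [realForm, Finset.mul_sum]
    exact Finset.sum_congr rfl fun k _ => by ring
  rw [form, e, eval_add, eval_finsetSum, add_assoc, eval_mul, eval_C, Complex.real_smul,
    Finset.mul_sum, ← Finset.sum_add_distrib]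
  congr 1
  refine Finset.sum_congr rfl fun k hk => ?_
  have hk' := Finset.mem_Icc.1 hk
  rw [sMeas, (S.chainFormula hσ (k - (j + 1)) (j + 1) (by omega) (by omega)).cauchy, eval_mul,
    eval_C, Complex.real_smul]
  linear_combination ((-1) ^ k * (ε (j + 1) : ℂ)) * hP k hk z hz

/-- Each form of a multi-level Hermite–Padé vector is the Cauchy transform of the next one. -/
lemma System.form_eq_integral (S : System m (absMeasure σ) ε Δ) (hσ : HasSigns m σ ε)
    (hΔ : ∀ j, hull (σ j) = Δ j) {n : ℕ} {a : ℕ → ℂ[X]} (ha : IsML m σ n a) {j : ℕ} (hj : j < m)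
    {z : ℂ} (hz : Away (σ (j + 1)).variation z) : form m σ a j z =
      ε (j + 1) • ∫ t : ℝ, (z - t)⁻¹ * realForm m σ ε a (j + 1) t ∂(σ (j + 1)).variation := by
  obtain ⟨P, hP⟩ := S.exists_form_eq_add hσ a j
  have hne : (hull (σ (j + 1))).Nonempty := hΔ (j + 1) ▸ S.nonempty (by omega) (by omega)
  have h0 : Tendsto (fun y : ℝ => form m σ a j (y * Complex.I)) atTop (𝓝 0) := by
    rcases Nat.eq_zero_or_pos j with rfl | h
    · simpa using ha.form_zero.tendsto_pow_mul hne (k := 0) (by omega)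
    · simpa using (ha.form_pos j h hj).tendsto_pow_mul hne (k := 0) (by omega)
  have hi : Integrable (realForm m σ ε a (j + 1)) (σ (j + 1)).variation := by
    simpa using S.integrable_mul_realForm a (j := j + 1) (by omega) 1
  have hP0 : P = 0 := by
    refine eq_zero_of_tendsto_mul_I ?_
    have h1 := h0.sub ((tendsto_integral_mul_I hi).const_smul (ε (j + 1)))
    rw [smul_zero, sub_zero] at h1
    refine h1.congr' ?_
    filter_upwards [eventually_gt_atTop 0] with y hy
    rw [hP _ (away_mul_I _ hy), add_sub_cancel_right]
  rw [hP z hz, hP0, eval_zero, zero_add]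

/-- Iterates `System.form_eq_integral` downwards from 𝓐_m. The gap interval keeps x off the carrier
of the next measure, where that identity is valid. -/
lemma System.realForm_eq_iterCauchy (S : System m (absMeasure σ) ε Δ) (hσ : HasSigns m σ ε)
    (hΔ : ∀ j, hull (σ j) = Δ j) {n : ℕ} {a : ℕ → ℂ[X]} (ha : IsML m σ n a) (l : ℕ) :
    ∀ j, 1 ≤ j → j + l = m → ∀ x ∈ gapInterval m Δ j, realForm m σ ε a j x =
      (-1) ^ m * iterCauchy (absMeasure σ) ε (fun y : ℝ => (a m).eval (y : ℂ)) l (j + 1) x := by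
  induction l with
  | zero =>
    intro j _ hl x _
    obtain rfl : j = m := by omega
    simp [realForm, iterCauchy]
  | succ l ih =>
    intro j hj hl x hx
    rw [← S.form_ofReal hσ a (by omega), S.form_eq_integral hσ hΔ ha (by omega)
      (away_ofReal (S.isClosed (j + 1) (by omega) (by omega)) (S.ae_mem _ (by omega) (by omega))
        (hx.2 (by omega))), iterCauchy, mul_smul_comm, ← integral_const_mul]
    congr 1
    refine integral_congr_ae ?_
    filter_upwards [S.ae_mem_gapInterval (j := j + 1) (by omega) (by omega)] with t ht
    rw [ih (j + 1) (by omega) (by omega) t ht, Complex.real_smul]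
    push_cast
    ring

lemma System.bilin_eq_zero_of_isML (S : System m (absMeasure σ) ε Δ) (hm : 1 ≤ m)
    (hσ : HasSigns m σ ε) (hΔ : ∀ j, hull (σ j) = Δ j) {n : ℕ} {a : ℕ → ℂ[X]} (ha : IsML m σ n a)
    {k : ℕ} (hk : k < n) : bilin m (absMeasure σ) ε (X ^ k) (a m) = 0 := by
  have hne : (hull (σ 1)).Nonempty := hΔ 1 ▸ S.nonempty le_rfl hm
  have h := moments_eq_zero (ν := (σ 1).variation) hne
    (F := fun t => ε 1 * realForm m σ ε a 1 t) (f := form m σ a 0) (n := n) (k := k)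
    (fun k => by
      refine ((S.integrable_mul_realForm a le_rfl (X ^ k)).const_mul (ε 1 : ℂ)).congr
        (Eventually.of_forall fun x => ?_)
      simp only [eval_pow, eval_X]
      ring)
    (fun y hy => by
      rw [S.form_eq_integral hσ hΔ ha (by omega) (away_mul_I _ hy), Complex.real_smul,
        ← integral_const_mul]
      congr 1
      ext t
      ring)
    ha.form_zero hk
  have e : ∫ t : ℝ, (t : ℂ) ^ k * (ε 1 * realForm m σ ε a 1 t) ∂(σ 1).variation =
      (-1) ^ m * bilin m (absMeasure σ) ε (X ^ k) (a m) := by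
    rw [bilin, mul_smul_comm, Complex.real_smul, ← integral_const_mul, ← integral_const_mul]
    refine integral_congr_ae ?_
    filter_upwards [S.ae_mem_gapInterval le_rfl hm] with t ht
    rw [S.realForm_eq_iterCauchy hσ hΔ ha (m - 1) 1 le_rfl (by omega) t ht, eval_pow, eval_X]
    ring
  rw [e] at h
  exact (mul_eq_zero.1 h).resolve_left (pow_ne_zero _ (by norm_num))

/-- The last polynomial of a multi-level Hermite–Padé vector does not vanish. -/
lemma System.last_ne_zero_of_isML (S : System m (absMeasure σ) ε Δ)
    (hσ : HasSigns m σ ε) (hΔ : ∀ j, hull (σ j) = Δ j) {n : ℕ} {a : ℕ → ℂ[X]}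
    (ha : IsML m σ n a) : a m ≠ 0 := by
  intro h0
  -- Descending induction: once a_{k+1}, …, a_m vanish, 𝓐_k is the Cauchy transform of 0, yet also
  -- equals (-1)^k a_k.
  have key : ∀ l ≤ m, ∀ k, m - l ≤ k → k ≤ m → a k = 0 := by
    intro l
    induction l with
    | zero =>
      intro _ k h1 h2
      obtain rfl : k = m := by omega
      exact h0
    | succ l ih =>
      intro hl k h1 h2
      by_cases hk : m - l ≤ k
      · exact ih (by omega) k hk h2
      · have hz : ∀ i ∈ Finset.Icc (k + 1) m, a i = 0 := fun i hi => by
          rw [Finset.mem_Icc] at hi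
          exact ih (by omega) i (by omega) hi.2
        refine eq_zero_of_tendsto_mul_I (tendsto_const_nhds.congr' ?_)
        filter_upwards [eventually_gt_atTop 0] with y hy
        have h := S.form_eq_integral hσ hΔ ha (j := k) (by omega) (away_mul_I _ hy)
        have hr : realForm m σ ε a (k + 1) = 0 := by
          ext t
          exact Finset.sum_eq_zero fun i hi => by simp [hz i hi]
        rw [form, Finset.sum_eq_zero fun i hi => by simp [hz i hi]] at h
        simp only [hr, Pi.zero_apply, mul_zero, integral_zero, smul_zero, add_zero] at h
        exact ((mul_eq_zero.1 h).resolve_left (pow_ne_zero _ (by norm_num))).symm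
  obtain ⟨j, hj, hne⟩ := ha.nonzero
  exact hne (key m le_rfl j (by omega) hj)

end Forms

/-! ### The convolution kernel and Fubini -/

section Kernels

/-- The iterated Cauchy kernel of the measures `ε j • μ j, …, ε (j + l - 1) • μ (j + l - 1)`. -/
def iterKernel (μ : ℕ → Measure ℝ) (ε : ℕ → ℝ) : ℕ → ℕ → ℝ → ℝ → ℝ
  | 0, _, x, y => (x - y)⁻¹
  | l + 1, j, x, y => ε j * ∫ t, (x - t)⁻¹ * iterKernel μ ε l (j + 1) t y ∂μ j

/-- The absolute version of `iterKernel`. -/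
def absKernel (μ : ℕ → Measure ℝ) : ℕ → ℕ → ℝ → ℝ → ℝ≥0∞
  | 0, _, x, y => ‖(x - y)⁻¹‖ₑ
  | l + 1, j, x, y => ∫⁻ t, ‖(x - t)⁻¹‖ₑ * absKernel μ l (j + 1) t y ∂μ j

variable {m : ℕ} {μ : ℕ → Measure ℝ} {ε : ℕ → ℝ} {Δ : ℕ → Set ℝ} [∀ j, IsFiniteMeasure (μ j)]

lemma measurable_absKernel (l j : ℕ) :
    Measurable fun p : ℝ × ℝ => absKernel μ l j p.1 p.2 := by
  induction l generalizing j with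
  | zero => exact measurable_inv_sub.enorm
  | succ l ih =>
    refine Measurable.lintegral_prod_right'
      (f := fun q : (ℝ × ℝ) × ℝ => ‖(q.1.1 - q.2)⁻¹‖ₑ * absKernel μ l (j + 1) q.2 q.1.2) ?_
    exact (by fun_prop : Measurable fun q : (ℝ × ℝ) × ℝ => ‖(q.1.1 - q.2)⁻¹‖ₑ).mul
      ((ih (j + 1)).comp (by fun_prop : Measurable fun q : (ℝ × ℝ) × ℝ => (q.2, q.1.2)))

lemma stronglyMeasurable_iterKernel (l j : ℕ) :
    StronglyMeasurable fun p : ℝ × ℝ => iterKernel μ ε l j p.1 p.2 := by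
  induction l generalizing j with
  | zero => exact measurable_inv_sub.stronglyMeasurable
  | succ l ih =>
    refine StronglyMeasurable.const_mul (StronglyMeasurable.integral_prod_right
      (f := fun (p : ℝ × ℝ) t => (p.1 - t)⁻¹ * iterKernel μ ε l (j + 1) t p.2) ?_) (ε j)
    exact (by fun_prop : Measurable fun q : (ℝ × ℝ) × ℝ =>
      (q.1.1 - q.2)⁻¹).stronglyMeasurable.mul ((ih (j + 1)).comp_measurable
        (by fun_prop : Measurable fun q : (ℝ × ℝ) × ℝ => (q.2, q.1.2)))

omit [∀ j, IsFiniteMeasure (μ j)] in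
lemma enorm_iterKernel_le (hε : ∀ j, ε j = 1 ∨ ε j = -1) (l j : ℕ) (x y : ℝ) :
    ‖iterKernel μ ε l j x y‖ₑ ≤ absKernel μ l j x y := by
  induction l generalizing j x with
  | zero => exact le_rfl
  | succ l ih =>
    have h1 : ‖ε j‖ₑ = 1 := by rcases hε j with h | h <;> simp [h]
    rw [iterKernel, absKernel, enorm_mul, h1, one_mul]
    refine (enorm_integral_le_lintegral_enorm _).trans (lintegral_mono fun t => ?_)
    rw [enorm_mul]
    exact mul_le_mul_right (ih (j + 1) t) _

lemma lintegral_absKernel_mul {g : ℝ → ℝ≥0∞} (hg : Measurable g) (l j : ℕ) (x : ℝ) :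
    ∫⁻ y, absKernel μ l j x y * g y ∂μ (j + l) = absCauchy μ g (l + 1) j x := by
  induction l generalizing j x with
  | zero => rfl
  | succ l ih =>
    have hk := measurable_absKernel (μ := μ) l (j + 1)
    have hx : Measurable fun t : ℝ => ‖(x - t)⁻¹‖ₑ := by fun_prop
    rw [absCauchy]
    simp_rw [← ih, absKernel]
    have h1 : ∀ y, (∫⁻ t, ‖(x - t)⁻¹‖ₑ * absKernel μ l (j + 1) t y ∂μ j) * g y =
        ∫⁻ t, ‖(x - t)⁻¹‖ₑ * (absKernel μ l (j + 1) t y * g y) ∂μ j := fun y => by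
      have hm : Measurable fun t => ‖(x - t)⁻¹‖ₑ * absKernel μ l (j + 1) t y :=
        hx.mul (hk.comp measurable_prodMk_right)
      rw [← lintegral_mul_const _ hm]
      simp_rw [mul_assoc]
    have h2 : ∀ t, ‖(x - t)⁻¹‖ₑ * ∫⁻ y, absKernel μ l (j + 1) t y * g y ∂μ (j + 1 + l) =
        ∫⁻ y, ‖(x - t)⁻¹‖ₑ * (absKernel μ l (j + 1) t y * g y) ∂μ (j + 1 + l) := fun t =>
      (lintegral_const_mul _ ((hk.comp measurable_prodMk_left).mul hg)).symm
    simp_rw [h1, h2]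
    rw [show j + (l + 1) = j + 1 + l by omega]
    refine lintegral_lintegral_swap (Measurable.aemeasurable ?_)
    exact (hx.comp measurable_snd).mul ((hk.comp measurable_swap).mul (hg.comp measurable_fst))

/-- Fubini applies at those x where the absolute iterated transform of `g` is finite, which is
almost everywhere only. -/
lemma System.integral_iterKernel_smul (S : System m μ ε Δ) {g : ℝ → ℂ} (hg : Tame g) (l : ℕ) :
    ∀ j, 1 ≤ j → j + l + 1 ≤ m → ∀ᵐ x ∂μ j,
      ε (j + 1 + l) • ∫ y, iterKernel μ ε l (j + 1) x y • g y ∂μ (j + 1 + l) =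
        iterCauchy μ ε g (l + 1) (j + 1) x := by
  induction l with
  | zero => intro j _ _; exact Eventually.of_forall fun x => rfl
  | succ l ih =>
    intro j hj hl
    obtain ⟨D, n, hD, hDg⟩ := hg.bound
    have hfin := S.lintegral_mul_absCauchy (f := fun _ => 1) (C := 1) (k := 0) ENNReal.one_ne_top hD
      (by simp) hDg hj (l := l + 2) (by omega)
    simp only [one_mul] at hfin
    filter_upwards [ae_lt_top (measurable_absCauchy hg.stronglyMeasurable.enorm _ _) hfin]
      with x hx
    have hk := stronglyMeasurable_iterKernel (μ := μ) (ε := ε) l (j + 2)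
    have hxm : Measurable fun t : ℝ => (x - t)⁻¹ := by fun_prop
    have hm : StronglyMeasurable (Function.uncurry fun t y : ℝ =>
        (x - t)⁻¹ • iterKernel μ ε l (j + 2) t y • g y) :=
      (hxm.comp measurable_fst).stronglyMeasurable.smul
        (hk.smul (hg.stronglyMeasurable.comp_measurable measurable_snd))
    have hint : Integrable (Function.uncurry fun t y : ℝ =>
        (x - t)⁻¹ • iterKernel μ ε l (j + 2) t y • g y) ((μ (j + 1)).prod (μ (j + 2 + l))) := by
      refine ⟨hm.aestronglyMeasurable, ?_⟩
      rw [hasFiniteIntegral_iff_enorm, lintegral_prod _ hm.enorm.aemeasurable]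
      refine lt_of_le_of_lt (lintegral_mono fun t => ?_) hx
      rw [← lintegral_absKernel_mul hg.stronglyMeasurable.enorm, ← lintegral_const_mul]
      · refine lintegral_mono fun y => ?_
        simp only [Function.uncurry_apply_pair, enorm_smul]
        exact mul_le_mul_right (mul_le_mul_left (enorm_iterKernel_le S.sign _ _ _ _) _) _
      · exact ((measurable_absKernel l (j + 2)).comp measurable_prodMk_left).mul
          hg.stronglyMeasurable.enorm
    have h1 : ∀ y, iterKernel μ ε (l + 1) (j + 1) x y • g y =
        ε (j + 1) • ∫ t, (x - t)⁻¹ • iterKernel μ ε l (j + 2) t y • g y ∂μ (j + 1) := fun y => by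
      rw [iterKernel, mul_smul, ← integral_smul_const]
      simp_rw [mul_smul]
    rw [iterCauchy, show j + 1 + (l + 1) = j + 2 + l by omega]
    simp_rw [h1]
    rw [integral_smul, smul_comm, ← integral_integral_swap hint, ← integral_smul]
    congr 1
    refine integral_congr_ae ?_
    filter_upwards [ih (j + 1) (by omega) (by omega)] with t ht
    rw [← ht, integral_smul, smul_comm]

end Kernels

/-! ### The pairing equals the bilinear form -/

section Pairing

variable {m : ℕ} {σ : ℕ → SignedMeasure ℝ} {ε : ℕ → ℝ} {Δ : ℕ → Set ℝ}

lemma kernelAux_eq_iterKernel (hσ : HasSigns m σ ε) (l : ℕ) : ∀ j, 1 ≤ j → j + l ≤ m + 1 →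
    kernelAux σ l j = iterKernel (absMeasure σ) ε l j := by
  induction l with
  | zero => intro j _ _; rfl
  | succ l ih =>
    intro j h1 h2
    ext x y
    rw [kernelAux, iterKernel, lsmul_eq_flip, vectorIntegral_eq (hσ j h1 (by omega)), smul_eq_mul,
      ih (j + 1) (by omega) (by omega)]

lemma System.integrable_pairingIntegrand (S : System m (absMeasure σ) ε Δ) (hσ : HasSigns m σ ε)
    (hm : 2 ≤ m) (q p : ℂ[X]) :
    Integrable (fun z : ℝ × ℝ => pairingIntegrand m σ q p z.1 z.2)
      ((σ 1).variation.prod (σ m).variation) := by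
  obtain ⟨C, k, hC, hq⟩ := (tame_complex q).bound
  obtain ⟨D, n, hD, hp⟩ := (tame_complex p).bound
  have hqm := (tame_complex q).stronglyMeasurable
  have hpm := (tame_complex p).stronglyMeasurable
  simp only [pairingIntegrand, kernel, kernelAux_eq_iterKernel hσ (m - 2) 2 (by omega) (by omega)]
  have hmeas : StronglyMeasurable fun z : ℝ × ℝ => q.eval (z.1 : ℂ) *
      ((iterKernel (absMeasure σ) ε (m - 2) 2 z.1 z.2 : ℝ) : ℂ) * p.eval (z.2 : ℂ) :=
    ((hqm.comp_measurable measurable_fst).mul (Complex.continuous_ofReal.comp_stronglyMeasurable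
      (stronglyMeasurable_iterKernel _ _))).mul (hpm.comp_measurable measurable_snd)
  refine ⟨hmeas.aestronglyMeasurable, ?_⟩
  rw [hasFiniteIntegral_iff_enorm, lintegral_prod _ hmeas.enorm.aemeasurable]
  refine lt_of_le_of_lt (lintegral_mono fun x => ?_)
    (S.lintegral_mul_absCauchy hC hD hq hp le_rfl (l := m - 1) (by omega)).lt_top
  have e := lintegral_absKernel_mul (μ := absMeasure σ) hpm.enorm (m - 2) 2 x
  rw [show m - 2 + 1 = m - 1 by omega, show 2 + (m - 2) = m by omega] at e
  rw [show (1 : ℕ) + 1 = 2 from rfl, ← e, ← lintegral_const_mul]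
  · refine lintegral_mono fun y => ?_
    rw [enorm_mul, enorm_mul, mul_assoc]
    refine mul_le_mul_right (mul_le_mul_left ?_ _) _
    have := enorm_iterKernel_le (μ := absMeasure σ) S.sign (m - 2) 2 x y
    simpa [← ofReal_norm] using this
  · exact ((measurable_absKernel (m - 2) 2).comp measurable_prodMk_left).mul hpm.enorm

lemma System.pairing_eq_bilin (S : System m (absMeasure σ) ε Δ) (hσ : HasSigns m σ ε)
    (hm : 2 ≤ m) (q p : ℂ[X]) : pairing m σ q p = bilin m (absMeasure σ) ε q p := by
  have h := S.integral_iterKernel_smul (tame_complex p) (m - 2) 1 le_rfl (by omega)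
  rw [pairing, bilin, vectorIntegral_eq (hσ 1 le_rfl (by omega))]
  congr 1
  refine integral_congr_ae ?_
  filter_upwards [h] with x hx
  rw [show m - 2 + 1 = m - 1 by omega, show 1 + 1 + (m - 2) = m by omega] at hx
  rw [vectorIntegral_eq (hσ m (by omega) le_rfl), ← hx, mul_smul_comm, ← integral_const_mul]
  congr 1
  refine integral_congr_ae (Eventually.of_forall fun y => ?_)
  simp only [pairingIntegrand, kernel, kernelAux_eq_iterKernel hσ (m - 2) 2 (by omega) (by omega),
    Complex.real_smul]
  ring

end Pairing

/-! ### Exact degrees and nonvanishing -/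

section Biorthogonality

variable {m : ℕ} {σ : ℕ → SignedMeasure ℝ} {ε : ℕ → ℝ} {Δ : ℕ → Set ℝ}

lemma System.bilin_eq_zero_of_natDegree_lt (S : System m (absMeasure σ) ε Δ) (hm : 1 ≤ m)
    (hσ : HasSigns m σ ε) (hΔ : ∀ j, hull (σ j) = Δ j) {n : ℕ} {a : ℕ → ℂ[X]} (ha : IsML m σ n a)
    {q : ℂ[X]} (hq : q.natDegree < n) : bilin m (absMeasure σ) ε q (a m) = 0 := by
  rw [S.bilin_eq_sum hm q (a m) le_rfl]
  refine Finset.sum_eq_zero fun i hi => ?_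
  rw [S.bilin_eq_zero_of_isML hm hσ hΔ ha (by simp at hi; omega), mul_zero]

/-- The last polynomial of a multi-level Hermite–Padé vector of order `n` has degree `n`. -/
lemma System.natDegree_of_isML (S : System m (absMeasure σ) ε Δ) (hm : 1 ≤ m)
    (hσ : HasSigns m σ ε) (hΔ : ∀ j, hull (σ j) = Δ j) {n : ℕ} {a : ℕ → ℂ[X]}
    (ha : IsML m σ n a) : (a m).natDegree = n := by
  refine le_antisymm (natDegree_le_of_degree_le ha.degree_le) ?_
  by_contra! h
  -- Degree below n forces n ≥ 1, and then the n known orthogonality relations already suffice for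
  -- nondegeneracy.
  refine S.last_ne_zero_of_isML hσ hΔ ha (S.eq_zero_of_bilin hm (N := n - 1) (by omega) ?_)
  intro i hi
  exact S.bilin_eq_zero_of_isML hm hσ hΔ ha (by omega)

lemma System.bilin_ne_zero_of_isML (S : System m (absMeasure σ) ε Δ) (hm : 1 ≤ m)
    (hσ : HasSigns m σ ε) (hΔ : ∀ j, hull (σ j) = Δ j) {n : ℕ} {a : ℕ → ℂ[X]} (ha : IsML m σ n a)
    {q : ℂ[X]} (hq : q ≠ 0) (hqn : q.natDegree = n) : bilin m (absMeasure σ) ε q (a m) ≠ 0 := by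
  rw [S.bilin_eq_sum hm q (a m) hqn.le, Finset.sum_range_succ, Finset.sum_eq_zero, zero_add]
  -- Only the leading term of `q` survives. If x^n were also orthogonal to a_m, nondegeneracy with N
  -- = n would give a_m = 0.
  · refine mul_ne_zero (by simpa [← hqn] using hq) fun h0 => ?_
    refine S.last_ne_zero_of_isML hσ hΔ ha (S.eq_zero_of_bilin hm (N := n)
      (natDegree_le_of_degree_le ha.degree_le) fun i hi => ?_)
    rcases hi.lt_or_eq with h | rfl
    · exact S.bilin_eq_zero_of_isML hm hσ hΔ ha h
    · exact h0
  · intro i hi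
    rw [S.bilin_eq_zero_of_isML hm hσ hΔ ha (by simpa using hi), mul_zero]

end Biorthogonality

end

end Nikishin

theorem theorem2 (m : ℕ) (hm : 2 ≤ m) (σ : ℕ → SignedMeasure ℝ)
    (hσ : Nikishin.IsGenerator m σ)
    (a b : ℕ → ℕ → ℂ[X])
    (ha : ∀ n, Nikishin.IsML m σ n (a n))
    (hb : ∀ k, Nikishin.IsML m (Nikishin.reversed m σ) k (b k)) :
    ∃ h : ℕ → ℂ, (∀ n, h n ≠ 0) ∧
      ∀ n k,
        Integrable (fun p : ℝ × ℝ => Nikishin.pairingIntegrand m σ (b k m) (a n m) p.1 p.2)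
          ((σ 1).variation.prod (σ m).variation) ∧
        Nikishin.pairing m σ (b k m) (a n m) = if n = k then h n else 0 := by
  have hm1 : 1 ≤ m := by omega
  have S := hσ.system
  have hs := hσ.hasSigns
  have S' : Nikishin.System m (Nikishin.absMeasure (Nikishin.reversed m σ)) _ _ := S.reverse
  have hs' : Nikishin.HasSigns m (Nikishin.reversed m σ)
      (Nikishin.rev m fun j => Nikishin.signOf (σ j)) :=
    fun j h1 h2 => hs (m + 1 - j) (by omega) (by omega)
  have hdega := fun n => S.natDegree_of_isML hm1 hs (fun _ => rfl) (ha n)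
  have hdegb := fun k => S'.natDegree_of_isML hm1 hs' (fun _ => rfl) (hb k)
  refine ⟨fun n => Nikishin.pairing m σ (b n m) (a n m), fun n => ?_, fun n k =>
    ⟨S.integrable_pairingIntegrand hs hm _ _, ?_⟩⟩
  · beta_reduce
    rw [S.pairing_eq_bilin hs hm]
    exact S.bilin_ne_zero_of_isML hm1 hs (fun _ => rfl) (ha n)
      (S'.last_ne_zero_of_isML hs' (fun _ => rfl) (hb n)) (hdegb n)
  · split_ifs with hnk
    · rw [hnk]
    · rw [S.pairing_eq_bilin hs hm]
      rcases lt_or_gt_of_ne hnk with h | h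
      -- For n < k the orthogonality of b_{k,m} is used, in the reversed system, against a_{n,m} of
      -- degree n.
      · have h0 := S'.bilin_eq_zero_of_natDegree_lt hm1 hs' (fun _ => rfl) (hb k)
          (q := a n m) (by rw [hdega]; exact h)
        rw [S.bilin_comm hm1]
        exact mul_eq_zero_of_right _ h0
      · exact S.bilin_eq_zero_of_natDegree_lt hm1 hs (fun _ => rfl) (ha n)
          (by rw [hdegb]; exact h)
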